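/- Let $d\ge 1$ be an integer, $T>0$, and let $p(n)\in(0,1]$ ($n=1,2,\dots$) satisfy $np(n)\to\infty$. Let $\mu$ be a probability measure on $\mathbb{R}^d$ and $\lambda$ a probability measure on $\mathbb{R}$ with a density in $L^1(\mathbb{R})\cap L^q(\mathbb{R})$ for some $q>1$. Let $W:\mathbb{R}^d\times\mathbb{R}^d\to[0,\infty)$ be bounded, symmetric and Lipschitz with $p(n)\|W\|_\infty\le 1$ for all $n$, and let $\phi:\mathbb{R}\times\mathbb{R}\times\mathbb{R}^d\times\mathbb{R}^d\to\mathbb{R}$ and $\psi:\mathbb{R}\times\mathbb{R}^d\to\mathbb{R}$ be bounded differentiable functions with bounded derivatives. For each $n$ let $\xi^{(n)}\sim\lambda^{\otimes n}$, $\omega^{(n)}\sim\mu^{\otimes n}$ and $B^{(n)}\sim\mathcal{W}^{\otimes n}$ be independent, where $\mathcal{W}$ is the standard Wiener measure on $C([0,T],\mathbb{R})$, and let $A^{(n)}$ be a random symmetric $\{0,1\}$-valued $n\times n$ matrix whose entries $A^{(n)}_{i,j}$, $i\le j$, are, conditionally on $(\xi^{(n)},\omega^{(n)},B^{(n)})$,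 independent with $\mathbb{P}(A^{(n)}_{i,j}=1\mid \xi^{(n)},\omega^{(n)},B^{(n)})=p(n)\,W(\omega^{(n)}_i,\omega^{(n)}_j)$. Let $\theta^{(n)}$ and $\overline{\theta}^{(n)}$ be strong solutions on $[0,T]$ of \[ d\theta^{(n)}_i(t)=\Big(\tfrac{1}{np(n)}\sum_{j=1}^n A^{(n)}_{i,j}\,\phi\big(\theta^{(n)}_i(t),\theta^{(n)}_j(t),\omega^{(n)}_i,\omega^{(n)}_j\big)+\psi\big(\theta^{(n)}_i(t),\omega^{(n)}_i\big)\Big)dt+dB^{(n)}_i(t), \] \[ d\overline{\theta}^{(n)}_i(t)=\Big(\tfrac1n\sum_{j=1}^n W(\omega^{(n)}_i,\omega^{(n)}_j)\,\phi\big(\overline{\theta}^{(n)}_i(t),\overline{\theta}^{(n)}_j(t),\omega^{(n)}_i,\omega^{(n)}_j\big)+\psi\big(\overline{\theta}^{(n)}_i(t),\omega^{(n)}_i\big)\Big)dt+dB^{(n)}_i(t), \] for $1\le i\le n$, with the same initial condition $\theta^{(n)}(0)=\overline{\theta}^{(n)}(0)=\xi^{(n)}$ and the same Brownian motions. Put $L_n=\frac1n\sum_{i=1}^n\delta_{(\theta^{(n)}_i,\omega^{(n)}_i)}$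 and $\overline{L}_n=\frac1n\sum_{i=1}^n\delta_{(\overline{\theta}^{(n)}_i,\omega^{(n)}_i)}$. On the probability measures on a metric space $S$ let $d_{BL}(P,Q)=\sup\{|\int f\,dP-\int f\,dQ| : f:S\to\mathbb{R},\ 2(\|f\|_\infty+\|f\|_{\mathrm{Lip}})\le 1\}$, where $\|f\|_{\mathrm{Lip}}$ is the smallest Lipschitz constant of $f$. Then $L_n$ and $\overline{L}_n$ are exponentially equivalent random elements of the space of probability measures on $C([0,T],\mathbb{R})\times\mathbb{R}^d$ with the metric $d_{BL}$: \[ \forall \eta>0:\quad \limsup_{n\to\infty}\frac1n\log\mathbb{P}\big(d_{BL}(L_n,\overline{L}_n)>\eta\big)=-\infty. \] -/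

import Mathlib

open MeasureTheory ProbabilityTheory Filter
open scoped ENNReal ProbabilityTheory

noncomputable section

namespace SparseDiffusion

/-! ### The bounded Lipschitz metric -/

section BoundedLipschitz

variable {S : Type*} [MetricSpace S]

/-- `‖f‖_∞`, as an extended nonnegative real. -/
def supNorm (f : S → ℝ) : ℝ≥0∞ := ⨆ x, ‖f x‖ₑ

/-- `‖f‖_Lip`, the supremum of the difference quotients. -/
def lipNorm (f : S → ℝ) : ℝ≥0∞ := ⨆ x, ⨆ y, ⨆ _ : x ≠ y, ‖f x - f y‖ₑ / edist x y

/-- `‖f‖_BL = 2 (‖f‖_∞ + ‖f‖_Lip)`. -/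
def blNorm (f : S → ℝ) : ℝ≥0∞ := 2 * (supNorm f + lipNorm f)

/-- The bounded Lipschitz distance `d_BL` between two probability measures. The set below is
nonempty and bounded (by 1), so the supremum is a genuine one. -/
def dBL [MeasurableSpace S] (P Q : ProbabilityMeasure S) : ℝ :=
  sSup {r : ℝ | ∃ f : S → ℝ, blNorm f ≤ 1 ∧
    r = |∫ x, f x ∂(P : Measure S) - ∫ x, f x ∂(Q : Measure S)|}

end BoundedLipschitz

/-! ### Exponential equivalence -/

/-- Exponential equivalence, with respect to a distance `d`, of two sequences of random elements
of `S`, where `X n` and `Y n` live on the same probability space `(Ω n, P n)`. The conventions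
are `log 0 = -∞`, and the limit is in the extended reals. -/
def ExponentiallyEquivalent {S : Type*} [MeasurableSpace S] (d : S → S → ℝ)
    {Ω : ℕ+ → Type*} [∀ n, MeasurableSpace (Ω n)] (P : ∀ n, Measure (Ω n))
    (X Y : ∀ n, Ω n → S) : Prop :=
  (∀ n, AEMeasurable (X n) (P n)) ∧ (∀ n, AEMeasurable (Y n) (P n)) ∧
  ∀ η : ℝ, 0 < η →
    limsup (fun n : ℕ+ => (((n : ℝ)⁻¹ : ℝ) : EReal) *
      ENNReal.log (P n {w | η < d (X n w) (Y n w)})) atTop = ⊥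

/-! ### Path space and Wiener measure -/

/-- `C([0,T], ℝ)` with the uniform distance. -/
abbrev PathSpace (T : ℝ) : Type := C(Set.Icc (0 : ℝ) T, ℝ)

/-- The Borel sigma-algebra of the path space. -/
instance pathMeasurableSpace (T : ℝ) : MeasurableSpace (PathSpace T) := borel _

instance pathBorelSpace (T : ℝ) : BorelSpace (PathSpace T) := ⟨rfl⟩

/-- `ν` is the standard Wiener measure on `C([0,T], ℝ)`: under `ν` the coordinate process starts
at `0` and has independent increments, the one from `s` to `t` being `N(0, t - s)`. -/
structure IsWienerMeasure {T : ℝ} (ν : Measure (PathSpace T)) : Prop where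
  start_zero : ∀ᵐ x ∂ν, ∀ t : Set.Icc (0 : ℝ) T, (t : ℝ) = 0 → x t = 0
  indep_increments :
    HasIndepIncrements (fun (t : Set.Icc (0 : ℝ) T) (x : PathSpace T) => x t) ν
  gaussian_increments : ∀ s t : Set.Icc (0 : ℝ) T, s ≤ t →
    HasLaw (fun x : PathSpace T => x t - x s)
      (gaussianReal 0 (Real.toNNReal ((t : ℝ) - (s : ℝ)))) ν

/-! ### Assumptions on the ingredients -/

/-- A bounded, everywhere differentiable function with bounded derivative. -/
def BoundedWithBoundedDeriv {F : Type*} [NormedAddCommGroup F] [NormedSpace ℝ F]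
    (f : F → ℝ) : Prop :=
  (∃ C : ℝ, ∀ z, |f z| ≤ C) ∧ Differentiable ℝ f ∧ ∃ C : ℝ, ∀ z, ‖fderiv ℝ f z‖ ≤ C

/-- `lam` has a density with respect to Lebesgue measure, lying in `L¹ ∩ L^q` for some `q > 1`. -/
def HasIntegrableDensity (lam : Measure ℝ) : Prop :=
  ∃ ρ : ℝ → ℝ, ∃ q : ℝ≥0∞, (∀ x, 0 ≤ ρ x) ∧ 1 < q ∧ MemLp ρ 1 volume ∧ MemLp ρ q volume ∧
    lam = volume.withDensity (fun x => ENNReal.ofReal (ρ x))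

/-- The function `W` is nonnegative, bounded, symmetric and Lipschitz. -/
structure IsEdgeFunction {E : Type*} [PseudoMetricSpace E] (W : E → E → ℝ) : Prop where
  nonneg : ∀ a b, 0 ≤ W a b
  bounded : ∃ C : ℝ, ∀ a b, W a b ≤ C
  symm : ∀ a b, W a b = W b a
  lipschitz : ∃ K : NNReal, LipschitzWith K (fun z : E × E => W z.1 z.2)

/-! ### The two systems of interacting diffusions -/

section Model

variable {E : Type*} [MeasurableSpace E] {n : ℕ} {T : ℝ} {Ω : Type*} [MeasurableSpace Ω]

/-- The random input of the `n`-particle systems: initial conditions `ξ ~ lam^{⊗ n}`, media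
variables `om ~ mu^{⊗ n}` and driving noise `B ~ Wiener^{⊗ n}`, all independent, together with a
symmetric `{0,1}`-matrix `A` whose entries `A i j`, `i ≤ j`, are, conditionally on `(ξ, om, B)`,
independent Bernoulli variables with parameters `p * W (om i) (om j)`. -/
structure IsModelInput (lam : Measure ℝ) (mu : Measure E) (W : E → E → ℝ) (p : ℝ)
    (P : Measure Ω) (ξ : Ω → Fin n → ℝ) (om : Ω → Fin n → E)
    (B : Ω → Fin n → PathSpace T) (A : Ω → Fin n → Fin n → ℝ) : Prop where
  measurable_init : Measurable ξ
  measurable_media : Measurable om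
  measurable_noise : Measurable B
  measurable_graph : Measurable A
  wiener : ∀ i, IsWienerMeasure (P.map (fun w => B w i))
  joint_law : HasLaw (fun w => (ξ w, om w, B w))
    ((Measure.pi fun _ => lam).prod
      ((Measure.pi fun _ => mu).prod (Measure.pi fun i => P.map (fun w => B w i)))) P
  zero_or_one : ∀ w i j, A w i j = 0 ∨ A w i j = 1
  graph_symm : ∀ w i j, A w i j = A w j i
  graph_law : ∀ a : Fin n → Fin n → ℝ, (∀ i j, a i j = 0 ∨ a i j = 1) →
    P⟦{w | ∀ i j, i ≤ j → A w i j = a i j} |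
        MeasurableSpace.comap (fun w => (ξ w, om w, B w)) inferInstance⟧
      =ᵐ[P] fun w => ∏ i, ∏ j ∈ Finset.Ici i,
        (a i j * (p * W (om w i) (om w j)) + (1 - a i j) * (1 - p * W (om w i) (om w j)))

/-- The information at time `t`: generated by `ξ`, `om`, `A` and the noise up to time `t`. -/
abbrev history (ξ : Ω → Fin n → ℝ) (om : Ω → Fin n → E) (B : Ω → Fin n → PathSpace T)
    (A : Ω → Fin n → Fin n → ℝ) (t : Set.Icc (0 : ℝ) T) : MeasurableSpace Ω :=
  MeasurableSpace.comap
    (fun w => (ξ w, om w, A w, fun (i : Fin n) (s : Set.Iic t) => B w i s)) inferInstance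

/-- `X` is a strong solution on `[0,T]` of the system
`dX_i(t) = (∑ j, M i j * φ (X_i(t), X_j(t), om i, om j) + ψ (X_i(t), om i)) dt + dB_i(t)`,
`X(0) = ξ`, with random interaction matrix `M`: it is a random element of `C([0,T], ℝ)^n`,
adapted to the given information (up to null sets), and almost surely satisfies the integral
form of the equations. (`Set.projIcc 0 T _ s` is just `s`, for `s ∈ [0,T]`.) -/
structure IsStrongSolution (hT : 0 < T) (φ : ℝ × ℝ × E × E → ℝ) (ψ : ℝ × E → ℝ)
    (P : Measure Ω) (ξ : Ω → Fin n → ℝ) (om : Ω → Fin n → E) (B : Ω → Fin n → PathSpace T)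
    (info : Set.Icc (0 : ℝ) T → MeasurableSpace Ω) (M : Ω → Fin n → Fin n → ℝ)
    (X : Ω → Fin n → PathSpace T) : Prop where
  aemeasurable : AEMeasurable X P
  adapted : ∀ t i, ∃ g : Ω → ℝ, Measurable[info t] g ∧ (fun w => X w i t) =ᵐ[P] g
  equation : ∀ᵐ w ∂P, ∀ (i : Fin n) (t : Set.Icc (0 : ℝ) T),
    X w i t = ξ w i
      + (∫ s in (0 : ℝ)..(t : ℝ),
          ((∑ j, M w i j * φ (X w i (Set.projIcc 0 T hT.le s), X w j (Set.projIcc 0 T hT.le s),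
              om w i, om w j))
            + ψ (X w i (Set.projIcc 0 T hT.le s), om w i)))
      + B w i t

end Model

/-- The empirical measure `(1/n) ∑ i, δ_{x i}`. -/
def empiricalMeasure {S : Type*} [MeasurableSpace S] (n : ℕ+) (x : Fin n → S) :
    ProbabilityMeasure S :=
  ⟨((n : ℕ) : ℝ≥0∞)⁻¹ • ∑ i, Measure.dirac (x i), ⟨by
    simp [ENNReal.inv_mul_cancel]⟩⟩

end SparseDiffusion

end

/-!
The two systems are driven by the same noise, so `d_BL (L_n, L̄_n)` is at most the average over the
particles of the uniform distance between `θ_i` and `θ̄_i` (`dBL_empiricalMeasure_le`), and the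
claim is that this average exceeds `η` only with probability `exp (-L n)`, for every `L` and all large
`n`. The comparison is made by replacing the graph by its mean *along the path of `θ`*, that is,
through the error
`E(s) = (1/n) ∑ i, |(1/(n p)) ∑ j, (A i j - p W i j) φ(θ_i(s), θ_j(s), ω_i, ω_j)|`.
The remaining difference of drifts only involves the bounded matrix `W`, so no control of individual
degrees, which may be much larger than `n p`, is needed, and Grönwall's inequality gives an average
distance of at most a constant times `∫₀ᵀ E(s) ds` (`average_dist_le_of_solvesSystem`).

The path `θ` depends on the graph, so `E(s)` has to be bounded uniformly over all paths. This is
what the cut norm does. For fixed `u, v ∈ {-1, 0, 1}ⁿ` the sum `∑ u_i v_j (A i j - p W i j)` exceeds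
`τ n² p` with probability at most `exp (-κ n² p)`, which beats the `9ⁿ` choices of `u` and `v` at
every exponential rate because `n p → ∞` (`exists_measure_signedSum_gt_le`). On the complement,
`E(s)` is small deterministically: particles with `(θ_i(s), ω_i)` in a large ball are moved to the
points of a finite `δ`-net, at which `φ` takes finitely many values, and this leaves finitely many
signed sums; the other particles are few and touch few edges (`sum_abs_interaction_le`).

That few particles leave a large ball follows from exponential Chebyshev bounds for the i.i.d.
variables `ξ_i`, `ω_i` and `∫₀ᵀ |B_i(s)| ds`, and from the total number of edges, which is itself
controlled by a signed sum (`integral_average_interactionError_le`). Only the time integral of the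
proportion of particles outside the ball matters, so one-time marginals of the Brownian motions
suffice.
-/

namespace SparseDiffusion

/-! ### Empirical measures and the bounded Lipschitz distance -/

lemma measurable_empiricalMeasure {S : Type*} [MeasurableSpace S] (n : ℕ+) :
    Measurable (fun x : Fin n → S => empiricalMeasure n x) := by
  refine Measurable.subtype_mk ?_
  refine Measure.measurable_of_measurable_coe _ fun s hs => ?_
  simp only [Measure.smul_apply, Measure.finsetSum_apply, smul_eq_mul]
  refine Measurable.const_mul (Finset.measurable_sum _ fun i _ => ?_) _
  simp only [Measure.dirac_apply' _ hs]
  exact (measurable_one.indicator hs).comp (measurable_pi_apply i)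

lemma integral_empiricalMeasure {S : Type*} [MeasurableSpace S] [MeasurableSingletonClass S]
    (n : ℕ+) (x : Fin n → S) (f : S → ℝ) :
    ∫ z, f z ∂(empiricalMeasure n x : Measure S) = (n : ℝ)⁻¹ * ∑ i, f (x i) := by
  change ∫ z, f z ∂(((n : ℕ) : ℝ≥0∞)⁻¹ • ∑ i, Measure.dirac (x i)) = _
  rw [integral_smul_measure, integral_finsetSum_measure]
  · simp [integral_dirac]
  · intro i _
    exact integrable_dirac (by simp)

lemma abs_sub_le_dist_of_blNorm_le_one {S : Type*} [MetricSpace S] {f : S → ℝ}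
    (hf : blNorm f ≤ 1) (x y : S) : |f x - f y| ≤ dist x y := by
  rcases eq_or_ne x y with rfl | hxy
  · simp
  have h1 : lipNorm f ≤ 1 := by
    refine le_trans ?_ hf
    unfold blNorm
    rw [two_mul]
    exact le_trans le_add_self (le_add_self)
  have h2 : ‖f x - f y‖ₑ / edist x y ≤ 1 := by
    refine le_trans ?_ h1
    unfold lipNorm
    exact le_iSup_of_le x (le_iSup_of_le y (le_iSup_of_le hxy le_rfl))
  have h3 : ‖f x - f y‖ₑ ≤ edist x y := by
    rw [ENNReal.div_le_iff (by simpa using hxy) (edist_ne_top x y), one_mul] at h2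
    exact h2
  rw [edist_dist, ← ofReal_norm, Real.norm_eq_abs,
    ENNReal.ofReal_le_ofReal_iff dist_nonneg] at h3
  exact h3

lemma dBL_empiricalMeasure_le {S : Type*} [MetricSpace S] [MeasurableSpace S]
    [MeasurableSingletonClass S] (n : ℕ+) (x y : Fin n → S) :
    dBL (empiricalMeasure n x) (empiricalMeasure n y)
      ≤ (n : ℝ)⁻¹ * ∑ i, dist (x i) (y i) := by
  refine Real.sSup_le ?_ (by positivity)
  rintro r ⟨f, hf, rfl⟩
  rw [integral_empiricalMeasure, integral_empiricalMeasure, ← mul_sub, ← Finset.sum_sub_distrib,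
    abs_mul, abs_of_nonneg (by positivity : (0 : ℝ) ≤ (n : ℝ)⁻¹)]
  gcongr
  exact (Finset.abs_sum_le_sum_abs _ _).trans
    (Finset.sum_le_sum fun i _ => abs_sub_le_dist_of_blNorm_le_one hf _ _)

/-! ### Exponential Chebyshev bounds for product measures -/

/-- Exponential Chebyshev inequality for a sum of independent variables. -/
lemma measure_pi_sum_gt_le {α : Type*} [MeasurableSpace α] {n : ℕ} (ν : Fin n → Measure α)
    [∀ i, IsProbabilityMeasure (ν i)] {f : α → ℝ} (hf : Measurable f) {c : ℝ}
    (hc : ∀ i, ∫⁻ x, ENNReal.ofReal (Real.exp (f x)) ∂(ν i) ≤ ENNReal.ofReal (Real.exp c))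
    (b : ℝ) :
    Measure.pi ν {x | b * n < ∑ i, f (x i)} ≤ ENNReal.ofReal (Real.exp ((c - b) * n)) := by
  have hm : ∀ i : Fin n, Measurable
      fun x : Fin n → α => ENNReal.ofReal (Real.exp (f (x i))) := fun i =>
    (Real.measurable_exp.comp (hf.comp (measurable_pi_apply i))).ennreal_ofReal
  have hind : iIndepFun (fun (i : Fin n) (x : Fin n → α) => ENNReal.ofReal (Real.exp (f (x i))))
      (Measure.pi ν) :=
    iIndepFun_pi (X := fun _ a => ENNReal.ofReal (Real.exp (f a)))
      fun i => (Real.measurable_exp.comp hf).ennreal_ofReal.aemeasurable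
  have h1 : ∫⁻ x, ∏ i, ENNReal.ofReal (Real.exp (f (x i))) ∂(Measure.pi ν)
      ≤ ENNReal.ofReal (Real.exp (c * n)) := by
    rw [lintegral_prod_eq_prod_lintegral_of_indepFun _ _ hind hm]
    calc _ ≤ ∏ i : Fin n, ENNReal.ofReal (Real.exp c) := by
          refine Finset.prod_le_prod' fun i _ => ?_
          have := (measurePreserving_eval ν i).lintegral_comp
            ((Real.measurable_exp.comp hf).ennreal_ofReal)
          simp only [Function.comp, Function.eval] at this
          rw [this]
          exact hc i
      _ = _ := by
          rw [Finset.prod_const, Finset.card_univ, Fintype.card_fin,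
            ← ENNReal.ofReal_pow (Real.exp_pos _).le, ← Real.exp_nat_mul, mul_comm]
  have h2 := mul_meas_ge_le_lintegral (μ := Measure.pi ν)
    (Finset.univ.measurable_prod fun i _ => hm i) (ENNReal.ofReal (Real.exp (b * n)))
  have h3 : Measure.pi ν {x | b * n < ∑ i, f (x i)} ≤
      Measure.pi ν {x | ENNReal.ofReal (Real.exp (b * n)) ≤
        ∏ i, ENNReal.ofReal (Real.exp (f (x i)))} := by
    refine measure_mono fun x hx => ?_
    simp only [Set.mem_ofPred_eq] at hx ⊢
    rw [← ENNReal.ofReal_prod_of_nonneg fun i _ => (Real.exp_pos _).le, ← Real.exp_sum]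
    exact ENNReal.ofReal_le_ofReal (Real.exp_le_exp.2 hx.le)
  have h4 : (1 : ℝ≥0∞) = ENNReal.ofReal (Real.exp (-(b * n))) *
      ENNReal.ofReal (Real.exp (b * n)) := by
    rw [← ENNReal.ofReal_mul (Real.exp_pos _).le, ← Real.exp_add]
    simp
  calc _ ≤ _ := h3
    _ = ENNReal.ofReal (Real.exp (-(b * n))) * (ENNReal.ofReal (Real.exp (b * n)) *
          Measure.pi ν {x | ENNReal.ofReal (Real.exp (b * n)) ≤
        ∏ i, ENNReal.ofReal (Real.exp (f (x i)))}) := by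
          rw [← mul_assoc, ← h4, one_mul]
    _ ≤ ENNReal.ofReal (Real.exp (-(b * n))) * ENNReal.ofReal (Real.exp (c * n)) := by
          gcongr
          exact h2.trans h1
    _ = _ := by
          rw [← ENNReal.ofReal_mul (Real.exp_pos _).le, ← Real.exp_add]
          ring_nf

/-- For i.i.d. samples, the proportion of points outside a large ball is small, up to an event of
exponentially small probability with an arbitrarily prescribed rate. -/
lemma exists_radius_measure_pi_le {E : Type*} [NormedAddCommGroup E] [MeasurableSpace E]
    [BorelSpace E] (ν : Measure E) [IsProbabilityMeasure ν] (L : ℝ) {ε : ℝ} (hε : 0 < ε) :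
    ∃ R₀ : ℝ, ∀ R, R₀ ≤ R → ∀ n : ℕ,
      Measure.pi (fun _ : Fin n => ν)
          {x | ε * n < ∑ i, Set.indicator {z : E | R < ‖z‖} (1 : E → ℝ) (x i)}
        ≤ ENNReal.ofReal (Real.exp (-L * n)) := by
  set a : ℝ := (max L 0 + 1) / ε with ha
  have hLm : 0 ≤ max L 0 := le_max_right _ _
  have ha0 : 0 < a := by positivity
  -- The exponential moment of `a` times the indicator is at most `1 + exp a * ν {R < ‖z‖}`.
  have htend : Tendsto (fun R : ℝ => ν {z : E | R < ‖z‖}) atTop (nhds 0) := by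
    have h := tendsto_measure_iInter_atTop (μ := ν) (s := fun R : ℝ => {z : E | R < ‖z‖})
      (fun R => (measurableSet_lt measurable_const measurable_norm).nullMeasurableSet)
      (fun R R' h z hz => lt_of_le_of_lt h hz) ⟨0, measure_ne_top _ _⟩
    have h0 : (⋂ R : ℝ, {z : E | R < ‖z‖}) = ∅ := by
      ext z
      simp only [Set.mem_iInter, Set.mem_ofPred_eq, Set.mem_empty_iff_false, iff_false, not_forall]
      exact ⟨‖z‖, lt_irrefl _⟩
    rwa [h0, measure_empty] at h
  have hpos : (0 : ℝ≥0∞) < ENNReal.ofReal ((Real.exp 1 - 1) / Real.exp a) := by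
    rw [ENNReal.ofReal_pos]
    have : (1 : ℝ) < Real.exp 1 := by simp
    have h2 : 0 < Real.exp 1 - 1 := by linarith
    positivity
  obtain ⟨R₀, hR₀⟩ := (htend.eventually_le_const hpos).exists_forall_of_atTop
  refine ⟨R₀, fun R hR n => ?_⟩
  have hms : MeasurableSet {z : E | R < ‖z‖} := measurableSet_lt measurable_const measurable_norm
  have hexp : ∫⁻ x, ENNReal.ofReal (Real.exp
      (a * Set.indicator {z : E | R < ‖z‖} (1 : E → ℝ) x)) ∂ν ≤ ENNReal.ofReal (Real.exp 1) := by
    calc _ ≤ ∫⁻ x, (1 + ENNReal.ofReal (Real.exp a) *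
            Set.indicator {z : E | R < ‖z‖} (1 : E → ℝ≥0∞) x) ∂ν := by
          refine lintegral_mono fun x => ?_
          by_cases hx : x ∈ {z : E | R < ‖z‖}
          · simp [hx]
          · simp [hx]
      _ = 1 + ENNReal.ofReal (Real.exp a) * ν {z : E | R < ‖z‖} := by
          rw [lintegral_add_left measurable_const,
            lintegral_const_mul _ (measurable_one.indicator hms), lintegral_indicator_one hms]
          simp
      _ ≤ 1 + ENNReal.ofReal (Real.exp a) * ENNReal.ofReal ((Real.exp 1 - 1) / Real.exp a) := by
          gcongr
          exact hR₀ R hR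
      _ = ENNReal.ofReal (Real.exp 1) := by
          have : (1 : ℝ) < Real.exp 1 := by simp
          rw [← ENNReal.ofReal_mul (Real.exp_pos _).le,
            mul_div_cancel₀ _ (Real.exp_pos a).ne', ← ENNReal.ofReal_one,
            ← ENNReal.ofReal_add zero_le_one (by linarith)]
          ring_nf
  have h := measure_pi_sum_gt_le (fun _ : Fin n => ν)
    (f := fun x => a * Set.indicator {z : E | R < ‖z‖} (1 : E → ℝ) x)
    (measurable_const.mul (measurable_one.indicator hms)) (fun _ => hexp) (a * ε)
  have hset : {x : Fin n → E |
      a * ε * n < ∑ i, a * Set.indicator {z : E | R < ‖z‖} (1 : E → ℝ) (x i)}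
      = {x | ε * n < ∑ i, Set.indicator {z : E | R < ‖z‖} (1 : E → ℝ) (x i)} := by
    ext x
    simp only [Set.mem_ofPred_eq, ← Finset.mul_sum, mul_assoc, mul_lt_mul_iff_right₀ ha0]
  rw [hset] at h
  refine h.trans (ENNReal.ofReal_le_ofReal (Real.exp_le_exp.2 ?_))
  have : a * ε = max L 0 + 1 := by rw [ha]; field_simp
  rw [this]
  have h2 := le_max_left L 0
  gcongr
  linarith

/-! ### Exponential moments of Brownian motion -/

/-- The time integral `∫₀ᵀ |x(s)| ds` of the modulus of a path. -/
noncomputable def absIntegral {T : ℝ} (hT : 0 < T) (x : PathSpace T) : ℝ :=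
  ∫ s in (0 : ℝ)..T, |x (Set.projIcc 0 T hT.le s)|

lemma continuous_abs_eval_projIcc {T : ℝ} (hT : 0 < T) :
    Continuous fun q : PathSpace T × ℝ => |q.1 (Set.projIcc 0 T hT.le q.2)| :=
  (ContinuousEval.continuous_eval.comp
    (continuous_fst.prodMk ((continuous_projIcc (h := hT.le)).comp continuous_snd))).abs

lemma continuous_absIntegral {T : ℝ} (hT : 0 < T) :
    Continuous (absIntegral hT) := by
  unfold absIntegral
  refine intervalIntegral.continuous_parametric_intervalIntegral_of_continuous' ?_ _ _
  exact continuous_abs_eval_projIcc hT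

lemma lintegral_exp_mul_abs_gaussianReal_le (v : NNReal) (a : ℝ) :
    ∫⁻ x, ENNReal.ofReal (Real.exp (a * |x|)) ∂(gaussianReal 0 v)
      ≤ ENNReal.ofReal (2 * Real.exp (v * a ^ 2 / 2)) := by
  have h (b : ℝ) : ∫⁻ x, ENNReal.ofReal (Real.exp (b * x)) ∂(gaussianReal 0 v)
      = ENNReal.ofReal (Real.exp (v * b ^ 2 / 2)) := by
    rw [← ofReal_integral_eq_lintegral_ofReal (integrable_exp_mul_gaussianReal b)
      (ae_of_all _ fun x => (Real.exp_pos _).le)]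
    have := mgf_gaussianReal (p := gaussianReal 0 v) (X := id) (μ := 0) (v := v)
      (by simp) b
    simp only [mgf, id, zero_mul, zero_add] at this
    rw [this]
  calc _ ≤ ∫⁻ x, (ENNReal.ofReal (Real.exp (a * x)) + ENNReal.ofReal (Real.exp (-a * x)))
          ∂(gaussianReal 0 v) := by
        refine lintegral_mono fun x => ?_
        rcases abs_cases x with ⟨h, _⟩ | ⟨h, _⟩
        · simp only [h]
          exact le_self_add
        · simp only [h]
          rw [neg_mul_comm]
          exact le_add_self
    _ = ENNReal.ofReal (Real.exp (v * a ^ 2 / 2)) + ENNReal.ofReal (Real.exp (v * a ^ 2 / 2)) := by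
        rw [lintegral_add_left (by fun_prop), h, h, neg_sq]
    _ = _ := by
        rw [← ENNReal.ofReal_add (Real.exp_pos _).le (Real.exp_pos _).le, two_mul]

/-- Under Wiener measure `∫₀ᵀ |x(s)| ds` has finite exponential moments: by Jensen's inequality
`exp (∫₀ᵀ |x(s)| ds)` is at most the time average of `exp (T |x(s)|)`. -/
lemma IsWienerMeasure.lintegral_exp_absIntegral_le {T : ℝ} (hT : 0 < T)
    {ν : Measure (PathSpace T)} [IsProbabilityMeasure ν] (hν : IsWienerMeasure ν) :
    ∫⁻ x, ENNReal.ofReal (Real.exp (absIntegral hT x)) ∂ν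
      ≤ ENNReal.ofReal (2 * Real.exp (T ^ 3 / 2)) := by
  have hcont : Continuous fun q : PathSpace T × ℝ => |q.1 (Set.projIcc 0 T hT.le q.2)| :=
    continuous_abs_eval_projIcc hT
  have hjensen : ∀ x : PathSpace T, ENNReal.ofReal (Real.exp (absIntegral hT x)) ≤
      ENNReal.ofReal T⁻¹ * ∫⁻ s in Set.Ioc 0 T,
        ENNReal.ofReal (Real.exp (T * |x (Set.projIcc 0 T hT.le s)|)) := by
    intro x
    have hcx : Continuous fun s : ℝ => |x (Set.projIcc 0 T hT.le s)| :=
      hcont.comp (continuous_const.prodMk continuous_id)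
    have hi : IntegrableOn (fun s : ℝ => T * |x (Set.projIcc 0 T hT.le s)|) (Set.Ioc 0 T) :=
      (continuous_const.mul hcx).integrableOn_Ioc
    have hi2 : IntegrableOn (Real.exp ∘ fun s : ℝ => T * |x (Set.projIcc 0 T hT.le s)|)
        (Set.Ioc 0 T) :=
      (Real.continuous_exp.comp (continuous_const.mul hcx)).integrableOn_Ioc
    have hJ := convexOn_exp.map_set_average_le (μ := volume) (t := Set.Ioc 0 T)
      Real.continuous_exp.continuousOn isClosed_univ (by simp [hT]) (by simp)
      (ae_of_all _ fun _ => Set.mem_univ _) hi hi2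
    rw [setAverage_eq, setAverage_eq, smul_eq_mul, smul_eq_mul, integral_const_mul] at hJ
    have hvol : (volume : Measure ℝ).real (Set.Ioc 0 T) = T := by
      simp [Measure.real, hT.le]
    rw [hvol, ← mul_assoc, inv_mul_cancel₀ hT.ne', one_mul] at hJ
    rw [absIntegral, intervalIntegral.integral_of_le hT.le]
    refine (ENNReal.ofReal_le_ofReal hJ).trans ?_
    rw [ENNReal.ofReal_mul (by positivity)]
    gcongr
    exact (ofReal_integral_eq_lintegral_ofReal hi2 (ae_of_all _ fun _ => (Real.exp_pos _).le)).le
  have hmeas : Measurable fun q : PathSpace T × ℝ =>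
      ENNReal.ofReal (Real.exp (T * |q.1 (Set.projIcc 0 T hT.le q.2)|)) :=
    (Real.continuous_exp.comp (continuous_const.mul hcont)).measurable.ennreal_ofReal
  have hmarg : ∀ s ∈ Set.Ioc 0 T, ∫⁻ x, ENNReal.ofReal (Real.exp
      (T * |x (Set.projIcc 0 T hT.le s)|)) ∂ν ≤ ENNReal.ofReal (2 * Real.exp (T ^ 3 / 2)) := by
    intro s hs
    set t : Set.Icc (0 : ℝ) T := Set.projIcc 0 T hT.le s with ht
    have hts : (t : ℝ) = s := by rw [ht, Set.projIcc_of_mem hT.le ⟨hs.1.le, hs.2⟩]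
    have hlaw := hν.gaussian_increments ⟨0, le_rfl, hT.le⟩ t (by
      change (0 : ℝ) ≤ t
      exact t.2.1)
    have h0 : ∀ᵐ x ∂ν, ENNReal.ofReal (Real.exp (T * |x t|)) =
        ENNReal.ofReal (Real.exp (T * |x t - x ⟨0, le_rfl, hT.le⟩|)) := by
      filter_upwards [hν.start_zero] with x hx
      rw [hx ⟨0, le_rfl, hT.le⟩ rfl, sub_zero]
    rw [lintegral_congr_ae h0]
    rw [hlaw.lintegral_comp (f := fun y => ENNReal.ofReal (Real.exp (T * |y|))) (by fun_prop)]
    refine (lintegral_exp_mul_abs_gaussianReal_le _ _).trans (ENNReal.ofReal_le_ofReal ?_)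
    simp only [sub_zero, hts]
    rw [Real.coe_toNNReal _ hs.1.le]
    have : s * T ^ 2 ≤ T ^ 3 := by
      have := hs.2
      rw [pow_succ' T 2]
      gcongr
    gcongr
  calc _ ≤ ∫⁻ x : PathSpace T, (ENNReal.ofReal T⁻¹ * ∫⁻ s in Set.Ioc 0 T,
        ENNReal.ofReal (Real.exp (T * |x (Set.projIcc 0 T hT.le s)|))) ∂ν := lintegral_mono hjensen
    _ = ENNReal.ofReal T⁻¹ * ∫⁻ s in Set.Ioc 0 T, (∫⁻ x : PathSpace T,
        ENNReal.ofReal (Real.exp (T * |x (Set.projIcc 0 T hT.le s)|)) ∂ν) := by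
        rw [lintegral_const_mul _ (by exact hmeas.lintegral_prod_right'), lintegral_lintegral_swap]
        exact hmeas.aemeasurable
    _ ≤ ENNReal.ofReal T⁻¹ * ∫⁻ s in Set.Ioc 0 T, ENNReal.ofReal (2 * Real.exp (T ^ 3 / 2)) := by
        gcongr ENNReal.ofReal T⁻¹ * ?_
        exact setLIntegral_mono measurable_const hmarg
    _ = _ := by
        rw [setLIntegral_const, Real.volume_Ioc, sub_zero, mul_left_comm,
          ← ENNReal.ofReal_mul (by positivity), inv_mul_cancel₀ hT.ne', ENNReal.ofReal_one,
          mul_one]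

/-! ### Concentration of the adjacency matrix in cut norm -/

/-- Exponential moment of a centred Bernoulli variable of parameter `r`. -/
lemma bernoulli_exp_moment_le {r u : ℝ} (h0 : 0 ≤ r) (hu : |u| ≤ 1) :
    r * Real.exp (u * (1 - r)) + (1 - r) * Real.exp (u * (0 - r)) ≤ Real.exp (r * u ^ 2) := by
  have h1 : Real.exp u ≤ 1 + u + u ^ 2 := by
    have := Real.abs_exp_sub_one_sub_id_le hu
    rw [abs_le] at this
    linarith [this.2]
  have h2 : 1 + r * (Real.exp u - 1) ≤ Real.exp (r * (u + u ^ 2)) := by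
    refine le_trans ?_ (Real.add_one_le_exp _)
    nlinarith
  calc _ = (1 + r * (Real.exp u - 1)) * Real.exp (-(u * r)) := by
        rw [show u * (1 - r) = u + -(u * r) by ring, show u * (0 - r) = -(u * r) by ring,
          Real.exp_add]
        ring
    _ ≤ Real.exp (r * (u + u ^ 2)) * Real.exp (-(u * r)) := by gcongr
    _ = _ := by rw [← Real.exp_add]; ring_nf

section Graph

variable {E : Type*} [MeasurableSpace E] {n : ℕ} {T : ℝ} {Ω : Type*} [MeasurableSpace Ω]

/-- The index pairs `(i, j)` with `i ≤ j`. -/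
def upperPairs (n : ℕ) : Finset (Fin n × Fin n) := Finset.univ.filter fun e => e.1 ≤ e.2

lemma prod_Ici_eq_prod_upperPairs (f : Fin n → Fin n → ℝ) :
    ∏ i, ∏ j ∈ Finset.Ici i, f i j = ∏ e ∈ upperPairs n, f e.1 e.2 := by
  rw [upperPairs, Finset.prod_filter, ← Finset.univ_product_univ, Finset.prod_product]
  refine Finset.prod_congr rfl fun i _ => ?_
  rw [← Finset.prod_filter]
  refine Finset.prod_congr ?_ fun _ _ => rfl
  ext j
  simp

/-- Conditionally on the media variables the centred entries `A i j - p * W (om i) (om j)`,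
`i ≤ j`, are independent, so that their exponential moments factorise. -/
lemma IsModelInput.integral_exp_sum_le {lam : Measure ℝ} {mu : Measure E} {W : E → E → ℝ} {p : ℝ}
    {P : Measure Ω} [IsProbabilityMeasure P] {ξ : Ω → Fin n → ℝ} {om : Ω → Fin n → E}
    {B : Ω → Fin n → PathSpace T} {A : Ω → Fin n → Fin n → ℝ}
    (h : IsModelInput lam mu W p P ξ om B A) (hWm : Measurable fun z : E × E => W z.1 z.2)
    (h0 : ∀ a b, 0 ≤ p * W a b) (h1 : ∀ a b, p * W a b ≤ 1) {r : ℝ} (hr : ∀ a b, p * W a b ≤ r)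
    (c : Fin n × Fin n → ℝ) (hc : ∀ e, |c e| ≤ 1) :
    ∫⁻ w, ENNReal.ofReal (Real.exp
        (∑ e ∈ upperPairs n, c e * (A w e.1 e.2 - p * W (om w e.1) (om w e.2)))) ∂P
      ≤ ENNReal.ofReal (Real.exp (∑ e ∈ upperPairs n, r * c e ^ 2)) := by
  classical
  set U := upperPairs n with hU
  set Z : Ω → (Fin n → ℝ) × (Fin n → E) × (Fin n → PathSpace T) :=
    fun w => (ξ w, om w, B w) with hZ
  have hZm : Measurable Z := h.measurable_init.prodMk (h.measurable_media.prodMk h.measurable_noise)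
  have hGle := hZm.comap_le
  set q : Fin n × Fin n → Ω → ℝ := fun e w => p * W (om w e.1) (om w e.2) with hq
  have hqG : ∀ e, Measurable[MeasurableSpace.comap Z inferInstance] (q e) := fun e => by
    have hg : Measurable fun z : (Fin n → ℝ) × (Fin n → E) × (Fin n → PathSpace T) =>
        p * W (z.2.1 e.1) (z.2.1 e.2) := by
      refine measurable_const.mul (hWm.comp (Measurable.prodMk ?_ ?_))
      · exact (measurable_pi_apply _).comp (measurable_fst.comp measurable_snd)
      · exact (measurable_pi_apply _).comp (measurable_fst.comp measurable_snd)
    exact hg.comp (comap_measurable Z)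
  have hq0 : ∀ e w, 0 ≤ q e w := fun e w => h0 _ _
  have hq1 : ∀ e w, q e w ≤ 1 := fun e w => h1 _ _
  -- A configuration is encoded by the set `t` of edges that are present.
  let cfg : Finset (Fin n × Fin n) → Fin n → Fin n → ℝ := fun t i j => if (i, j) ∈ t then 1 else 0
  have hcfg : ∀ t i j, cfg t i j = 0 ∨ cfg t i j = 1 := fun t i j => by
    by_cases hm : (i, j) ∈ t <;> simp [cfg, hm]
  let S : Finset (Fin n × Fin n) → Set Ω := fun t => {w | ∀ i j, i ≤ j → A w i j = cfg t i j}
  let g : Finset (Fin n × Fin n) → Ω → ℝ := fun t w =>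
    Real.exp (∑ e ∈ U, c e * (cfg t e.1 e.2 - q e w))
  have hSm : ∀ t, MeasurableSet (S t) := fun t => by
    have : S t = ⋂ i, ⋂ j, ⋂ (_ : i ≤ j), {w | A w i j = cfg t i j} := by
      ext w; simp [S]
    rw [this]
    refine MeasurableSet.iInter fun i => MeasurableSet.iInter fun j => MeasurableSet.iInter fun _ =>
      ?_
    exact ((measurable_pi_apply j).comp ((measurable_pi_apply i).comp h.measurable_graph))
      (measurableSet_singleton _)
  have hgG : ∀ t, Measurable[MeasurableSpace.comap Z inferInstance] (g t) := fun t =>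
    Real.measurable_exp.comp (Finset.measurable_sum _ fun e _ =>
      (measurable_const.sub (hqG e)).const_mul _)
  have hgb : ∀ t w, ‖g t w‖ ≤ Real.exp (∑ e ∈ U, (1 : ℝ)) := fun t w => by
    rw [Real.norm_eq_abs, abs_of_pos (Real.exp_pos _)]
    refine Real.exp_le_exp.2 (Finset.sum_le_sum fun e _ => ?_)
    refine (le_abs_self _).trans ?_
    rw [abs_mul]
    have hle : |cfg t e.1 e.2 - q e w| ≤ 1 := by
      have := hq0 e w
      have := hq1 e w
      rw [abs_le]
      rcases hcfg t e.1 e.2 with h' | h' <;> rw [h'] <;> constructor <;> linarith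
    exact mul_le_one₀ (hc e) (abs_nonneg _) hle
  have hint : ∀ t, Integrable (g t * (S t).indicator fun _ => (1 : ℝ)) P := fun t => by
    refine Integrable.bdd_mul (c := Real.exp (∑ e ∈ U, (1 : ℝ)))
      ((integrable_const _).indicator (hSm t)) ?_ (ae_of_all _ (hgb t))
    exact ((hgG t).mono hGle le_rfl).aestronglyMeasurable
  -- Decompose the exponential over the possible configurations.
  have hdecomp : ∀ w, Real.exp (∑ e ∈ U, c e * (A w e.1 e.2 - q e w)) =
      ∑ t ∈ U.powerset, (g t * (S t).indicator fun _ => (1 : ℝ)) w := fun w => by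
    set t₀ := U.filter fun e => A w e.1 e.2 = 1 with ht₀
    have hA : ∀ e ∈ U, A w e.1 e.2 = cfg t₀ e.1 e.2 := fun e he => by
      rcases h.zero_or_one w e.1 e.2 with h' | h' <;> simp [cfg, ht₀, h', he]
    have hmem : w ∈ S t₀ := fun i j hij => hA (i, j) (by simp [hU, upperPairs, hij])
    rw [Finset.sum_eq_single_of_mem t₀ (by simp [ht₀])]
    · simp only [Pi.mul_apply, Set.indicator_of_mem hmem, mul_one, g]
      congr 1
      exact Finset.sum_congr rfl fun e he => by rw [hA e he]
    · intro t ht hne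
      have : w ∉ S t := fun hw => hne <| by
        ext e
        rw [Finset.mem_powerset] at ht
        simp only [ht₀, Finset.mem_filter]
        by_cases heU : e ∈ U
        · have h3 := hw e.1 e.2 (by simpa [hU, upperPairs] using heU)
          by_cases het : e ∈ t <;> simp [cfg, het] at h3 <;> simp [het, heU, h3]
        · simp only [heU, false_and, iff_false]
          exact fun het => heU (ht het)
      simp [this]
  -- Integrate one configuration, using its conditional probability.
  have hone : ∀ t, ∫ w, (g t * (S t).indicator fun _ => (1 : ℝ)) w ∂P =
      ∫ w, g t w * ∏ e ∈ U, (cfg t e.1 e.2 * q e w + (1 - cfg t e.1 e.2) * (1 - q e w)) ∂P :=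
      fun t => by
    rw [← integral_condExp hGle]
    refine integral_congr_ae ?_
    have hpull := condExp_stronglyMeasurable_mul_of_bound hGle
      (hgG t).stronglyMeasurable ((integrable_const (1 : ℝ)).indicator (μ := P) (hSm t)) _
      (ae_of_all _ (hgb t))
    filter_upwards [hpull, h.graph_law (cfg t) (hcfg t)] with w hw1 hw2
    rw [hw1, Pi.mul_apply]
    congr 1
    refine hw2.trans ?_
    rw [prod_Ici_eq_prod_upperPairs]
  have hprodb : ∀ t w, ‖∏ e ∈ U, (cfg t e.1 e.2 * q e w + (1 - cfg t e.1 e.2) * (1 - q e w))‖ ≤ 1 :=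
      fun t w => by
    rw [norm_prod]
    refine Finset.prod_le_one (fun _ _ => norm_nonneg _) fun e _ => ?_
    have := hq0 e w
    have := hq1 e w
    rw [Real.norm_eq_abs, abs_le]
    rcases hcfg t e.1 e.2 with h' | h' <;> rw [h'] <;> constructor <;> linarith
  have hint2 : ∀ t, Integrable (fun w => g t w *
      ∏ e ∈ U, (cfg t e.1 e.2 * q e w + (1 - cfg t e.1 e.2) * (1 - q e w))) P := fun t => by
    refine Integrable.of_bound (C := Real.exp (∑ e ∈ U, (1 : ℝ)) * 1) ?_ (ae_of_all _ fun w => ?_)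
    · refine Measurable.aestronglyMeasurable (Measurable.mul ((hgG t).mono hGle le_rfl) ?_)
      exact Finset.measurable_prod _ fun e _ =>
        (((hqG e).mono hGle le_rfl).const_mul _).add
          ((measurable_const.sub ((hqG e).mono hGle le_rfl)).const_mul _)
    · rw [norm_mul]
      exact mul_le_mul (hgb t w) (hprodb t w) (norm_nonneg _) (Real.exp_pos _).le
  have hfact : ∀ w, ∑ t ∈ U.powerset, g t w *
      ∏ e ∈ U, (cfg t e.1 e.2 * q e w + (1 - cfg t e.1 e.2) * (1 - q e w)) =
      ∏ e ∈ U, (q e w * Real.exp (c e * (1 - q e w)) + (1 - q e w) * Real.exp (c e * (0 - q e w)))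
      := fun w => by
    rw [Finset.prod_add]
    refine Finset.sum_congr rfl fun t ht => ?_
    rw [Finset.mem_powerset] at ht
    simp only [g]
    rw [Real.exp_sum, ← Finset.prod_mul_distrib, ← Finset.prod_sdiff ht, mul_comm]
    congr 1
    · refine Finset.prod_congr rfl fun e he => ?_
      simp [cfg, he, mul_comm]
    · refine Finset.prod_congr rfl fun e he => ?_
      rw [Finset.mem_sdiff] at he
      simp [cfg, he.2, mul_comm]
  have hX : ∀ w, Real.exp (∑ e ∈ U, c e * (A w e.1 e.2 - p * W (om w e.1) (om w e.2))) =
      ∑ t ∈ U.powerset, (g t * (S t).indicator fun _ => (1 : ℝ)) w := hdecomp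
  have hXint : Integrable (fun w => Real.exp
      (∑ e ∈ U, c e * (A w e.1 e.2 - p * W (om w e.1) (om w e.2)))) P := by
    simp_rw [hX]
    exact integrable_finsetSum _ fun t _ => hint t
  rw [← ofReal_integral_eq_lintegral_ofReal hXint (ae_of_all _ fun _ => (Real.exp_pos _).le)]
  refine ENNReal.ofReal_le_ofReal ?_
  simp_rw [hX]
  rw [integral_finsetSum _ fun t _ => hint t, Finset.sum_congr rfl fun t _ => hone t,
    ← integral_finsetSum _ fun t _ => hint2 t]
  simp_rw [hfact]
  calc _ ≤ ∫ _, Real.exp (∑ e ∈ U, r * c e ^ 2) ∂P := by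
        refine integral_mono_of_nonneg (ae_of_all _ fun w => ?_) (integrable_const _)
          (ae_of_all _ fun w => ?_)
        · refine Finset.prod_nonneg fun e _ => ?_
          have := hq0 e w
          have : 0 ≤ 1 - q e w := sub_nonneg.2 (hq1 e w)
          positivity
        · simp only
          rw [Real.exp_sum]
          refine Finset.prod_le_prod (fun e _ => ?_) fun e _ => ?_
          · have := hq0 e w
            have : 0 ≤ 1 - q e w := sub_nonneg.2 (hq1 e w)
            positivity
          · refine (bernoulli_exp_moment_le (hq0 e w) (hc e)).trans (Real.exp_le_exp.2 ?_)
            exact mul_le_mul_of_nonneg_right (hr _ _) (sq_nonneg _)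
    _ = _ := by simp

/-- The signed sum `∑ i j, u i * v j * M i j`; its maximum over sign vectors `u`, `v` with values
in `{-1, 0, 1}` is the `∞ → 1` norm of `M`, which is equivalent to the cut norm. -/
noncomputable def signedSum (M : Fin n → Fin n → ℝ) (u v : Fin n → SignType) : ℝ :=
  ∑ i, ∑ j, (u i : ℝ) * (v j : ℝ) * M i j

lemma abs_signType_le_one (s : SignType) : |(s : ℝ)| ≤ 1 := by
  cases s <;> simp

/-- For a symmetric matrix a signed sum only involves the entries on and above the diagonal, with
coefficients at most `2`. -/
lemma exists_signedSum_eq_sum_upperPairs (u v : Fin n → SignType) :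
    ∃ c : Fin n × Fin n → ℝ, (∀ e, |c e| ≤ 2) ∧ ∀ M : Fin n → Fin n → ℝ,
      (∀ i j, M i j = M j i) → signedSum M u v = ∑ e ∈ upperPairs n, c e * M e.1 e.2 := by
  have hb : ∀ s t : SignType, |(s : ℝ) * (t : ℝ)| ≤ 1 := fun s t => by
    rw [abs_mul]
    exact mul_le_one₀ (abs_signType_le_one s) (abs_nonneg _) (abs_signType_le_one t)
  refine ⟨fun e => (u e.1 : ℝ) * v e.2 + if e.1 < e.2 then (u e.2 : ℝ) * v e.1 else 0,
    fun e => ?_, fun M hM => ?_⟩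
  · refine (abs_add_le _ _).trans ?_
    have h1 := hb (u e.1) (v e.2)
    have h2 := hb (u e.2) (v e.1)
    split_ifs
    · linarith
    · simp only [abs_zero]
      linarith
  · have hswap : ∑ e : Fin n × Fin n, (if e.2 < e.1 then (u e.1 : ℝ) * v e.2 * M e.1 e.2 else 0) =
        ∑ e : Fin n × Fin n, (if e.1 < e.2 then (u e.2 : ℝ) * v e.1 * M e.1 e.2 else 0) := by
      refine Fintype.sum_equiv (Equiv.prodComm _ _) _ _ fun e => ?_
      simp only [Equiv.prodComm_apply, Prod.fst_swap, Prod.snd_swap, hM e.1 e.2]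
      congr
    rw [signedSum, ← Finset.sum_product', Finset.univ_product_univ, upperPairs, Finset.sum_filter]
    calc _ = ∑ e : Fin n × Fin n, ((if e.1 ≤ e.2 then (u e.1 : ℝ) * v e.2 * M e.1 e.2 else 0) +
          if e.2 < e.1 then (u e.1 : ℝ) * v e.2 * M e.1 e.2 else 0) := by
          refine Finset.sum_congr rfl fun e _ => ?_
          rcases le_or_gt e.1 e.2 with h | h
          · simp [h, not_lt.2 h]
          · simp [h, not_le.2 h]
      _ = _ := by
          rw [Finset.sum_add_distrib, hswap, ← Finset.sum_add_distrib]
          refine Finset.sum_congr rfl fun e _ => ?_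
          by_cases h1 : e.1 ≤ e.2
          · by_cases h2 : e.1 < e.2 <;> simp [h1, h2, add_mul]
          · have h2 : ¬ e.1 < e.2 := fun h => h1 h.le
            simp [h1, h2]

/-- The centred and rescaled adjacency matrix is small in the `∞ → 1` norm, except on an event
whose probability is a union bound over `9 ^ n` sign vectors of Chernoff bounds of order
`exp (-κ n² p)`. -/
lemma exists_measure_signedSum_gt_le {W : E → E → ℝ} (hW0 : ∀ a b, 0 ≤ W a b)
    (hWs : ∀ a b, W a b = W b a) {C : ℝ} (hC : 0 ≤ C)
    (hWC : ∀ a b, W a b ≤ C) (hWm : Measurable fun z : E × E => W z.1 z.2) {τ : ℝ} (hτ : 0 < τ) :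
    ∃ κ : ℝ, 0 < κ ∧ ∀ (n : ℕ) (T : ℝ) (Ω : Type*) [MeasurableSpace Ω] (lam : Measure ℝ)
      (mu : Measure E) (p : ℝ) (P : Measure Ω) [IsProbabilityMeasure P] (ξ : Ω → Fin n → ℝ)
      (om : Ω → Fin n → E) (B : Ω → Fin n → PathSpace T) (A : Ω → Fin n → Fin n → ℝ),
      0 < p → (∀ a b, p * W a b ≤ 1) → IsModelInput lam mu W p P ξ om B A →
      P {w | ∃ u v, τ * (n ^ 2 * p) <
          signedSum (fun i j => A w i j - p * W (om w i) (om w j)) u v}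
        ≤ ENNReal.ofReal (9 ^ n * Real.exp (-κ * (n ^ 2 * p))) := by
  -- The Chernoff exponent `4 C s² - τ s` is at most `-τ s / 2` for this choice of `s`.
  set s : ℝ := min (1 / 2) (τ / (8 * (C + 1))) with hs
  have hs0 : 0 < s := lt_min (by norm_num) (by positivity)
  have hs1 : s ≤ 1 / 2 := min_le_left _ _
  have hs2 : 4 * s * C ≤ τ / 2 := by
    have h1 : s ≤ τ / (8 * (C + 1)) := min_le_right _ _
    rw [le_div_iff₀ (by positivity)] at h1
    nlinarith
  refine ⟨s * τ / 2, by positivity, ?_⟩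
  intro n T Ω _ lam mu p P _ ξ om B A hp hpW h
  have hsingle : ∀ u v : Fin n → SignType, P {w | τ * (n ^ 2 * p) <
      signedSum (fun i j => A w i j - p * W (om w i) (om w j)) u v} ≤
        ENNReal.ofReal (Real.exp (-(s * τ / 2) * (n ^ 2 * p))) := by
    intro u v
    obtain ⟨c, hc, hcM⟩ := exists_signedSum_eq_sum_upperPairs u v
    have hsym : ∀ w i j, A w i j - p * W (om w i) (om w j) = A w j i - p * W (om w j) (om w i) :=
      fun w i j => by rw [h.graph_symm w i j, hWs]
    have hc1 : ∀ e, |s * c e| ≤ 1 := fun e => by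
      rw [abs_mul, abs_of_pos hs0]
      nlinarith [hc e, abs_nonneg (c e)]
    have hmgf := h.integral_exp_sum_le hWm (fun a b => mul_nonneg hp.le (hW0 a b)) hpW
      (r := p * C) (fun a b => mul_le_mul_of_nonneg_left (hWC a b) hp.le) (fun e => s * c e) hc1
    have hsum : ∑ e ∈ upperPairs n, p * C * (s * c e) ^ 2 ≤ n ^ 2 * p * (4 * s * C) * s := by
      calc _ ≤ ∑ e ∈ upperPairs n, p * C * (s * 2) ^ 2 := by
            refine Finset.sum_le_sum fun e _ => ?_
            have : (s * c e) ^ 2 ≤ (s * 2) ^ 2 := by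
              rw [mul_pow, mul_pow, ← sq_abs (c e)]
              have := hc e
              gcongr
            gcongr
        _ ≤ n ^ 2 * (p * C * (s * 2) ^ 2) := by
            rw [Finset.sum_const, nsmul_eq_mul]
            gcongr
            have : (upperPairs n).card ≤ n ^ 2 := by
              refine (Finset.card_le_univ _).trans ?_
              simp [sq]
            exact_mod_cast this
        _ = _ := by ring
    have hmeasA : ∀ i j, Measurable fun w => A w i j := fun i j =>
      (measurable_pi_apply j).comp ((measurable_pi_apply i).comp h.measurable_graph)
    have hmeasom : ∀ i, Measurable fun w => om w i := fun i =>
      (measurable_pi_apply i).comp h.measurable_media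
    have hXm : Measurable fun w => ENNReal.ofReal (Real.exp (∑ e ∈ upperPairs n,
        s * c e * (A w e.1 e.2 - p * W (om w e.1) (om w e.2)))) := by
      refine (Real.measurable_exp.comp (Finset.measurable_sum _ fun e _ => ?_)).ennreal_ofReal
      refine measurable_const.mul ((hmeasA _ _).sub (measurable_const.mul ?_))
      exact hWm.comp ((hmeasom e.1).prodMk (hmeasom e.2))
    have hcheb := meas_ge_le_lintegral_div (μ := P) hXm.aemeasurable
      (ε := ENNReal.ofReal (Real.exp (s * (τ * (n ^ 2 * p)))))
      (by simpa using Real.exp_pos _) ENNReal.ofReal_ne_top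
    calc _ ≤ _ := measure_mono fun w hw => ?_
      _ ≤ _ := hcheb
      _ ≤ ENNReal.ofReal (Real.exp (n ^ 2 * p * (4 * s * C) * s)) /
          ENNReal.ofReal (Real.exp (s * (τ * (n ^ 2 * p)))) := by
          gcongr
          exact hmgf.trans (ENNReal.ofReal_le_ofReal (Real.exp_le_exp.2 hsum))
      _ ≤ _ := by
          rw [← ENNReal.ofReal_div_of_pos (Real.exp_pos _), ← Real.exp_sub]
          refine ENNReal.ofReal_le_ofReal (Real.exp_le_exp.2 ?_)
          have h1 : n ^ 2 * p * (4 * s * C) * s ≤ n ^ 2 * p * (τ / 2) * s := by gcongr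
          linarith
    simp only [Set.mem_ofPred_eq] at hw ⊢
    refine ENNReal.ofReal_le_ofReal (Real.exp_le_exp.2 ?_)
    rw [hcM _ (hsym w)] at hw
    simp_rw [mul_assoc, ← Finset.mul_sum]
    exact mul_le_mul_of_nonneg_left hw.le hs0.le
  have hunion : {w | ∃ u v, τ * (n ^ 2 * p) <
      signedSum (fun i j => A w i j - p * W (om w i) (om w j)) u v} =
      ⋃ q : (Fin n → SignType) × (Fin n → SignType), {w | τ * (n ^ 2 * p) <
      signedSum (fun i j => A w i j - p * W (om w i) (om w j)) q.1 q.2} := by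
    ext w
    simp
  rw [hunion]
  refine (measure_iUnion_fintype_le P _).trans ?_
  refine (Finset.sum_le_sum fun q _ => hsingle q.1 q.2).trans (le_of_eq ?_)
  have hcard : Fintype.card SignType = 3 := rfl
  rw [Finset.sum_const, Finset.card_univ, Fintype.card_prod, Fintype.card_fun, Fintype.card_fin,
    hcard, ← mul_pow, nsmul_eq_mul, ENNReal.ofReal_mul (by positivity)]
  congr 1
  rw [← ENNReal.ofReal_natCast]
  norm_num

end Graph

/-! ### From the cut norm to nonlinear interactions -/

section Discretisation

variable {n : ℕ} {V : Type*}

/-- A kernel that only takes into account finitely many classes of points sees a matrix through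
its signed sums. -/
lemma sum_abs_sum_mul_classes_le {Δ : Fin n → Fin n → ℝ} {τ : ℝ}
    (hτ : ∀ u v, signedSum Δ u v ≤ τ) {Φ : V → V → ℝ} {M : ℝ}
    (hΦ : ∀ x y, |Φ x y| ≤ M) (good : Fin n → Prop) [DecidablePred good] (c : Fin n → V)
    (F : Finset V) (hF : ∀ i, good i → c i ∈ F) :
    ∑ i, |∑ j, Δ i j * (if good i ∧ good j then Φ (c i) (c j) else 0)| ≤
      (F.card : ℝ) ^ 2 * M * τ := by
  classical
  have habs : ∀ u v, |signedSum Δ u v| ≤ τ := fun u v => by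
    refine abs_le'.2 ⟨hτ u v, ?_⟩
    have h := hτ (fun i => - u i) v
    simpa [signedSum] using h
  set X : Fin n → ℝ := fun i => ∑ j, Δ i j * (if good i ∧ good j then Φ (c i) (c j) else 0) with hX
  let u : V → Fin n → SignType := fun a i => if good i ∧ c i = a then SignType.sign (X i) else 0
  let v : V → Fin n → SignType := fun b j => if good j ∧ c j = b then 1 else 0
  have hpt : ∀ i j, (SignType.sign (X i) : ℝ) *
      (Δ i j * (if good i ∧ good j then Φ (c i) (c j) else 0)) =
      ∑ a ∈ F, ∑ b ∈ F, Φ a b * ((u a i : ℝ) * (v b j : ℝ) * Δ i j) := fun i j => by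
    by_cases hi : good i
    · by_cases hj : good j
      · rw [Finset.sum_eq_single_of_mem (c i) (hF i hi)
          (fun a _ ha => Finset.sum_eq_zero fun b _ => by simp [u, ha.symm]),
          Finset.sum_eq_single_of_mem (c j) (hF j hj) (fun b _ hb => by simp [v, hb.symm])]
        simp only [hi, hj, u, v, and_self, if_true, SignType.coe_one]
        ring
      · simp [hj, v]
    · simp [hi, u]
  calc ∑ i, |X i| = ∑ i, (SignType.sign (X i) : ℝ) * X i :=
        Finset.sum_congr rfl fun i _ => (sign_mul_self (X i)).symm
    _ = ∑ i, ∑ j, ∑ a ∈ F, ∑ b ∈ F, Φ a b * ((u a i : ℝ) * (v b j : ℝ) * Δ i j) := by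
        refine Finset.sum_congr rfl fun i _ => ?_
        conv_lhs => rw [hX]
        simp only [Finset.mul_sum]
        exact Finset.sum_congr rfl fun j _ => hpt i j
    _ = ∑ a ∈ F, ∑ b ∈ F, Φ a b * signedSum Δ (u a) (v b) := by
        simp only [signedSum, Finset.mul_sum]
        rw [Finset.sum_congr rfl fun i _ => Finset.sum_comm, Finset.sum_comm]
        refine Finset.sum_congr rfl fun a _ => ?_
        rw [Finset.sum_congr rfl fun i _ => Finset.sum_comm, Finset.sum_comm]
    _ ≤ ∑ a ∈ F, ∑ b ∈ F, M * τ := by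
        refine Finset.sum_le_sum fun a _ => Finset.sum_le_sum fun b _ => ?_
        refine (le_abs_self _).trans ?_
        rw [abs_mul]
        exact mul_le_mul (hΦ a b) (habs _ _) (abs_nonneg _) ((abs_nonneg _).trans (hΦ a b))
    _ = _ := by
        simp only [Finset.sum_const, nsmul_eq_mul]
        ring

/-- Uniform smallness of the interaction with respect to the centred graph. The points `z i` in a
totally bounded set are moved to a finite `δ`-net `F`; the others are discarded, at a cost governed
by the number of edges that they touch. -/
lemma sum_abs_interaction_le [PseudoMetricSpace V] {A Q : Fin n → Fin n → ℝ} {τ q : ℝ}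
    (hA : ∀ i j, 0 ≤ A i j) (hQ0 : ∀ i j, 0 ≤ Q i j) (hQ : ∀ i j, Q i j ≤ q)
    (hτ : ∀ u v, signedSum (fun i j => A i j - Q i j) u v ≤ τ)
    {Φ : V → V → ℝ} {M δ ε : ℝ} (hM : 0 ≤ M) (hΦ : ∀ x y, |Φ x y| ≤ M) (hε : 0 ≤ ε)
    (hΦε : ∀ x y x' y', dist x x' ≤ δ → dist y y' ≤ δ → |Φ x y - Φ x' y'| ≤ ε)
    {s : Set V} (F : Finset V) (hF : ∀ x ∈ s, ∃ y ∈ F, dist x y ≤ δ) (z : Fin n → V) :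
    ∑ i, |∑ j, (A i j - Q i j) * Φ (z i) (z j)| ≤
      ((F.card : ℝ) ^ 2 + 2) * M * τ + ε * (τ + 2 * q * n ^ 2)
        + 4 * M * q * n * ∑ i, sᶜ.indicator (1 : V → ℝ) (z i) := by
  classical
  have hch : ∀ x, ∃ y, x ∈ s → y ∈ F ∧ dist x y ≤ δ := fun x => by
    by_cases hx : x ∈ s
    · obtain ⟨y, hy⟩ := hF x hx
      exact ⟨y, fun _ => hy⟩
    · exact ⟨x, fun h => absurd h hx⟩
  choose c hc using hch
  set b : Fin n → ℝ := fun i => sᶜ.indicator (1 : V → ℝ) (z i) with hb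
  set Ψ : Fin n → Fin n → ℝ := fun i j =>
    if z i ∈ s ∧ z j ∈ s then Φ (c (z i)) (c (z j)) else 0 with hΨ
  have hmain : ∑ i, |∑ j, (A i j - Q i j) * Ψ i j| ≤ (F.card : ℝ) ^ 2 * M * τ :=
    sum_abs_sum_mul_classes_le hτ hΦ (fun i => z i ∈ s) (fun i => c (z i)) F
      fun i hi => (hc _ hi).1
  have hb0 : ∀ i, 0 ≤ b i := fun i => Set.indicator_nonneg (fun _ _ => zero_le_one) _
  have herr : ∀ i j, |Φ (z i) (z j) - Ψ i j| ≤ ε + M * b i + M * b j := fun i j => by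
    by_cases h : z i ∈ s ∧ z j ∈ s
    · have h1 := hΦε _ _ _ _ (hc _ h.1).2 (hc _ h.2).2
      simp only [hΨ, if_pos h]
      have := mul_nonneg hM (hb0 i)
      have := mul_nonneg hM (hb0 j)
      linarith
    · simp only [hΨ, if_neg h, sub_zero]
      refine (hΦ _ _).trans ?_
      rw [not_and_or] at h
      rcases h with h | h
      · have h1 : b i = 1 := by simp [hb, h]
        have := mul_nonneg hM (hb0 j)
        rw [h1]; linarith
      · have h1 : b j = 1 := by simp [hb, h]
        have := mul_nonneg hM (hb0 i)
        rw [h1]; linarith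
  have hΔ : ∀ i j, |A i j - Q i j| ≤ (A i j - Q i j) + 2 * Q i j := fun i j => by
    rw [abs_le]
    constructor <;> linarith [hA i j, hQ0 i j]
  -- Total edge counts, weighted by the indicators of bad points, through signed sums.
  have hall : ∑ i, ∑ j, |A i j - Q i j| ≤ τ + 2 * q * n ^ 2 := by
    have h1 := hτ (fun _ => 1) (fun _ => 1)
    simp only [signedSum, SignType.coe_one, one_mul] at h1
    calc _ ≤ ∑ i, ∑ j, ((A i j - Q i j) + 2 * q) :=
          Finset.sum_le_sum fun i _ => Finset.sum_le_sum fun j _ => by linarith [hΔ i j, hQ i j]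
      _ = ∑ i, ∑ j, (A i j - Q i j) + 2 * q * n ^ 2 := by
          simp only [Finset.sum_add_distrib, Finset.sum_const, Finset.card_univ, Fintype.card_fin,
            nsmul_eq_mul]
          ring
      _ ≤ _ := by linarith
  have hrow : ∑ i, ∑ j, |A i j - Q i j| * b i ≤ τ + 2 * q * n * ∑ i, b i := by
    have h1 := hτ (fun i => if z i ∈ s then 0 else 1) (fun _ => 1)
    have hu : ∀ i, (((if z i ∈ s then 0 else 1 : SignType)) : ℝ) = b i := fun i => by
      by_cases h : z i ∈ s <;> simp [h, hb]
    simp only [signedSum, SignType.coe_one, mul_one, hu] at h1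
    calc _ ≤ ∑ i, ∑ j, (b i * (A i j - Q i j) + 2 * q * b i) :=
          Finset.sum_le_sum fun i _ => Finset.sum_le_sum fun j _ => by
            nlinarith [mul_le_mul_of_nonneg_right ((hΔ i j).trans
              (add_le_add_right (mul_le_mul_of_nonneg_left (hQ i j) zero_le_two) _)) (hb0 i)]
      _ = ∑ i, ∑ j, b i * (A i j - Q i j) + 2 * q * n * ∑ i, b i := by
          simp only [Finset.sum_add_distrib, Finset.sum_const, Finset.card_univ, Fintype.card_fin,
            nsmul_eq_mul, Finset.mul_sum]
          congr 1
          exact Finset.sum_congr rfl fun i _ => by ring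
      _ ≤ _ := by linarith
  have hcol : ∑ i, ∑ j, |A i j - Q i j| * b j ≤ τ + 2 * q * n * ∑ i, b i := by
    have h1 := hτ (fun _ => 1) (fun i => if z i ∈ s then 0 else 1)
    have hu : ∀ i, (((if z i ∈ s then 0 else 1 : SignType)) : ℝ) = b i := fun i => by
      by_cases h : z i ∈ s <;> simp [h, hb]
    simp only [signedSum, SignType.coe_one, one_mul, hu] at h1
    calc _ ≤ ∑ i, ∑ j, (b j * (A i j - Q i j) + 2 * q * b j) :=
          Finset.sum_le_sum fun i _ => Finset.sum_le_sum fun j _ => by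
            nlinarith [mul_le_mul_of_nonneg_right ((hΔ i j).trans
              (add_le_add_right (mul_le_mul_of_nonneg_left (hQ i j) zero_le_two) _)) (hb0 j)]
      _ = ∑ i, ∑ j, b j * (A i j - Q i j) + 2 * q * n * ∑ i, b i := by
          simp only [Finset.sum_add_distrib, Finset.sum_const, Finset.card_univ, Fintype.card_fin,
            nsmul_eq_mul, ← Finset.mul_sum]
          ring
      _ ≤ _ := by linarith
  calc _ ≤ ∑ i, (|∑ j, (A i j - Q i j) * Ψ i j| +
          ∑ j, (ε * |A i j - Q i j| +
            M * (|A i j - Q i j| * b i) + M * (|A i j - Q i j| * b j))) := by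
        refine Finset.sum_le_sum fun i _ => ?_
        have : ∑ j, (A i j - Q i j) * Φ (z i) (z j) = ∑ j, (A i j - Q i j) * Ψ i j +
            ∑ j, (A i j - Q i j) * (Φ (z i) (z j) - Ψ i j) := by
          rw [← Finset.sum_add_distrib]
          exact Finset.sum_congr rfl fun j _ => by ring
        rw [this]
        refine (abs_add_le _ _).trans (add_le_add_right ?_ _)
        refine (Finset.abs_sum_le_sum_abs _ _).trans (Finset.sum_le_sum fun j _ => ?_)
        rw [abs_mul]
        nlinarith [mul_le_mul_of_nonneg_left (herr i j) (abs_nonneg (A i j - Q i j))]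
    _ = ∑ i, |∑ j, (A i j - Q i j) * Ψ i j| + ε * ∑ i, ∑ j, |A i j - Q i j|
          + M * ∑ i, ∑ j, |A i j - Q i j| * b i + M * ∑ i, ∑ j, |A i j - Q i j| * b j := by
        simp only [Finset.sum_add_distrib, Finset.mul_sum, add_assoc]
    _ ≤ (F.card : ℝ) ^ 2 * M * τ + ε * (τ + 2 * q * n ^ 2) + M * (τ + 2 * q * n * ∑ i, b i)
          + M * (τ + 2 * q * n * ∑ i, b i) := by gcongr
    _ = _ := by ring

end Discretisation

/-! ### Stability of the interacting system -/

/-- Grönwall's inequality for systems coupled through averages. -/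
lemma average_dist_le_of_integral_inequality {T : ℝ} (hT : 0 < T) {n : ℕ}
    (x y : Fin n → PathSpace T) {e : Fin n → ℝ → ℝ} (he : ∀ i, Continuous (e i)) (he0 : ∀ i s, 0 ≤ e i s) {K : ℝ} (hK : 0 < K)
    {ε : ℝ} (hε : ∫ s in (0 : ℝ)..T, (n : ℝ)⁻¹ * ∑ i, e i s ≤ ε)
    (h : ∀ (i : Fin n) (t : Set.Icc (0 : ℝ) T), |x i t - y i t| ≤ ∫ s in (0 : ℝ)..t,
      (e i s + K * (|x i (Set.projIcc 0 T hT.le s) - y i (Set.projIcc 0 T hT.le s)| +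
        (n : ℝ)⁻¹ * ∑ j, |x j (Set.projIcc 0 T hT.le s) - y j (Set.projIcc 0 T hT.le s)|))) :
    (n : ℝ)⁻¹ * ∑ i, dist (x i) (y i) ≤ ε * Real.exp (2 * K * T) := by
  rcases Nat.eq_zero_or_pos n with rfl | hn
  · simp at hε ⊢
    positivity
  have hn0 : (0 : ℝ) < n := by exact_mod_cast hn
  set D : Fin n → ℝ → ℝ := fun i s =>
    |x i (Set.projIcc 0 T hT.le s) - y i (Set.projIcc 0 T hT.le s)| with hD
  set S : ℝ → ℝ := fun s => (n : ℝ)⁻¹ * ∑ j, D j s with hS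
  have hDc : ∀ i, Continuous (D i) := fun i =>
    (((x i).continuous.comp continuous_projIcc).sub ((y i).continuous.comp continuous_projIcc)).abs
  have hSc : Continuous S := continuous_const.mul (continuous_finsetSum _ fun i _ => hDc i)
  have hD0 : ∀ i s, 0 ≤ D i s := fun i s => abs_nonneg _
  have hS0 : ∀ s, 0 ≤ S s := fun s =>
    mul_nonneg (by positivity) (Finset.sum_nonneg fun i _ => hD0 i s)
  set f : Fin n → ℝ → ℝ := fun i s => e i s + K * (D i s + S s) with hf
  have hfc : ∀ i, Continuous (f i) := fun i =>
    (he i).add (continuous_const.mul ((hDc i).add hSc))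
  have hf0 : ∀ i s, 0 ≤ f i s := fun i s =>
    add_nonneg (he0 i s) (mul_nonneg hK.le (add_nonneg (hD0 i s) (hS0 s)))
  have hmono : ∀ g : ℝ → ℝ, Continuous g → (∀ s, 0 ≤ g s) → ∀ t t' : ℝ, 0 ≤ t → t ≤ t' →
      ∫ s in (0 : ℝ)..t, g s ≤ ∫ s in (0 : ℝ)..t', g s := fun g hg hg0 t t' h0 htt' =>
    intervalIntegral.integral_mono_interval le_rfl h0 htt' (ae_of_all _ hg0)
      (hg.intervalIntegrable _ _)
  set G : ℝ → ℝ := fun t => ∫ s in (0 : ℝ)..t, S s with hG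
  -- The averaged right-hand sides of the hypothesis are controlled by the integral `G`.
  have havg : ∀ t, 0 ≤ t → t ≤ T →
      (n : ℝ)⁻¹ * ∑ i, ∫ s in (0 : ℝ)..t, f i s ≤ ε + 2 * K * G t := by
    intro t h0 hT'
    rw [← intervalIntegral.integral_finsetSum fun i _ => (hfc i).intervalIntegrable _ _,
      ← intervalIntegral.integral_const_mul]
    have : ∀ s, (n : ℝ)⁻¹ * ∑ i, f i s = (n : ℝ)⁻¹ * ∑ i, e i s + 2 * K * S s := fun s => by
      simp only [hf, hS, Finset.sum_add_distrib, ← Finset.mul_sum, Finset.sum_const,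
        Finset.card_univ, Fintype.card_fin, nsmul_eq_mul]
      field_simp
      ring
    simp_rw [this]
    have hec : Continuous fun s => (n : ℝ)⁻¹ * ∑ i, e i s :=
      continuous_const.mul (continuous_finsetSum _ fun i _ => he i)
    rw [intervalIntegral.integral_add (hec.intervalIntegrable _ _)
      ((hSc.const_mul (2 * K)).intervalIntegrable _ _), intervalIntegral.integral_const_mul (2 * K)]
    gcongr
    exact (hmono _ hec (fun s => mul_nonneg (by positivity)
      (Finset.sum_nonneg fun i _ => he0 i s)) t T h0 hT').trans hε
  have hε0 : 0 ≤ ε := le_trans (intervalIntegral.integral_nonneg hT.le fun s _ =>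
    mul_nonneg (by positivity) (Finset.sum_nonneg fun i _ => he0 i s)) hε
  have hSG : ∀ t, 0 ≤ t → t ≤ T → S t ≤ ε + 2 * K * G t := fun t h0 hT' => by
    refine le_trans ?_ (havg t h0 hT')
    simp only [hS]
    gcongr with i
    have := h i ⟨t, h0, hT'⟩
    simpa only [hD, Set.projIcc_of_mem hT.le (⟨h0, hT'⟩ : t ∈ Set.Icc 0 T)] using this
  have hG0 : ∀ t, 0 ≤ t → 0 ≤ G t := fun t h0 =>
    intervalIntegral.integral_nonneg h0 fun s _ => hS0 s
  have hGd : ∀ t, HasDerivAt G (S t) t := fun t =>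
    intervalIntegral.integral_hasDerivAt_right (hSc.intervalIntegrable _ _)
      hSc.aestronglyMeasurable.stronglyMeasurableAtFilter hSc.continuousAt
  -- `G' = S ≤ ε + 2 K G`, so that the differential form of Grönwall's inequality applies to `G`.
  have hGT : G T ≤ gronwallBound 0 (2 * K) ε (T - 0) := by
    have := norm_le_gronwallBound_of_norm_deriv_right_le (f := G) (f' := S) (δ := 0) (K := 2 * K)
      (ε := ε) (a := 0) (b := T) (fun t _ => (hGd t).continuousAt.continuousWithinAt)
      (fun t _ => (hGd t).hasDerivWithinAt) (by simp [hG]) (fun t ht => by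
        rw [Real.norm_eq_abs, Real.norm_eq_abs, abs_of_nonneg (hS0 t), abs_of_nonneg (hG0 t ht.1)]
        linarith [hSG t ht.1 ht.2.le]) T ⟨hT.le, le_rfl⟩
    exact (le_abs_self _).trans this
  rw [gronwallBound_of_K_ne_0 (by positivity), sub_zero] at hGT
  simp only [zero_mul, zero_add] at hGT
  have hdist : ∀ i, dist (x i) (y i) ≤ ∫ s in (0 : ℝ)..T, f i s := fun i => by
    rw [ContinuousMap.dist_le (intervalIntegral.integral_nonneg hT.le fun s _ => hf0 i s)]
    intro t
    rw [Real.dist_eq]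
    exact (h i t).trans (hmono _ (hfc i) (hf0 i) t T t.2.1 t.2.2)
  calc _ ≤ (n : ℝ)⁻¹ * ∑ i, ∫ s in (0 : ℝ)..T, f i s := by
        gcongr with i
        exact hdist i
    _ ≤ ε + 2 * K * G T := havg T hT.le le_rfl
    _ ≤ ε + 2 * K * (ε / (2 * K) * (Real.exp (2 * K * T) - 1)) := by gcongr
    _ = _ := by
        field_simp
        ring

section Pathwise

variable {E : Type*} [NormedAddCommGroup E] {n : ℕ} {T : ℝ}

/-- The integral equation of the interacting system, for a fixed realisation of the initial
conditions `ξ`, the media variables `om`, the noise `b` and the interaction matrix `M`. -/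
def SolvesSystem (hT : 0 < T) (φ : ℝ × ℝ × E × E → ℝ) (ψ : ℝ × E → ℝ) (ξ : Fin n → ℝ)
    (om : Fin n → E) (b : Fin n → PathSpace T) (M : Fin n → Fin n → ℝ) (x : Fin n → PathSpace T) :
    Prop :=
  ∀ (i : Fin n) (t : Set.Icc (0 : ℝ) T), x i t = ξ i
    + (∫ s in (0 : ℝ)..(t : ℝ),
        ((∑ j, M i j * φ (x i (Set.projIcc 0 T hT.le s), x j (Set.projIcc 0 T hT.le s),
            om i, om j))
          + ψ (x i (Set.projIcc 0 T hT.le s), om i)))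
    + b i t

lemma continuous_drift (hT : 0 < T) {φ : ℝ × ℝ × E × E → ℝ} (hφ : Continuous φ) {ψ : ℝ × E → ℝ}
    (hψ : Continuous ψ) (om : Fin n → E) (M : Fin n → Fin n → ℝ) (x : Fin n → PathSpace T)
    (i : Fin n) :
    Continuous fun s : ℝ => (∑ j, M i j * φ (x i (Set.projIcc 0 T hT.le s),
      x j (Set.projIcc 0 T hT.le s), om i, om j)) + ψ (x i (Set.projIcc 0 T hT.le s), om i) := by
  have hx : ∀ j, Continuous fun s : ℝ => x j (Set.projIcc 0 T hT.le s) := fun j =>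
    (x j).continuous.comp continuous_projIcc
  refine (continuous_finsetSum _ fun j _ => continuous_const.mul (hφ.comp ?_)).add (hψ.comp ?_)
  · exact (hx i).prodMk ((hx j).prodMk continuous_const)
  · exact (hx i).prodMk continuous_const

/-- The effect on the `i`-th drift, at time `s`, of replacing the averaged interaction matrix by the
random one, along the path `x`. -/
noncomputable def interactionError (hT : 0 < T) (φ : ℝ × ℝ × E × E → ℝ) (om : Fin n → E)
    (Δ : Fin n → Fin n → ℝ) (x : Fin n → PathSpace T) (i : Fin n) (s : ℝ) : ℝ :=
  |∑ j, Δ i j * φ (x i (Set.projIcc 0 T hT.le s), x j (Set.projIcc 0 T hT.le s), om i, om j)|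

lemma continuous_interactionError (hT : 0 < T) {φ : ℝ × ℝ × E × E → ℝ} (hφ : Continuous φ)
    (om : Fin n → E) (Δ : Fin n → Fin n → ℝ) (x : Fin n → PathSpace T) (i : Fin n) :
    Continuous (interactionError hT φ om Δ x i) := by
  have := continuous_drift hT hφ (ψ := fun _ => 0) continuous_const om Δ x i
  simp only [add_zero] at this
  exact this.abs

lemma abs_sub_le_of_lipschitzWith_fst {φ : ℝ × ℝ × E × E → ℝ} {K : NNReal} (hφ : LipschitzWith K φ)
    (a b a' b' : ℝ) (z z' : E) :
    |φ (a, b, z, z') - φ (a', b', z, z')| ≤ K * (|a - a'| + |b - b'|) := by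
  have h := hφ.dist_le_mul (a, b, z, z') (a', b', z, z')
  rw [Real.dist_eq] at h
  refine h.trans (mul_le_mul_of_nonneg_left ?_ K.2)
  simp only [Prod.dist_eq, dist_self, Real.dist_eq]
  have h1 := abs_nonneg (a - a')
  have h2 := abs_nonneg (b - b')
  exact max_le (by linarith) (max_le (by linarith) (by positivity))

/-- Two solutions driven by the same noise, with interaction matrices `M` and `N`: their average
distance is controlled by the error made by replacing `N` by `M` along the first solution. Only the
entries of `N` are required to be bounded. -/
lemma average_dist_le_of_solvesSystem (hT : 0 < T) (hn : 0 < n) {φ : ℝ × ℝ × E × E → ℝ}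
    {Kφ : NNReal} (hφ : LipschitzWith Kφ φ) {ψ : ℝ × E → ℝ} {Kψ : NNReal} (hψ : LipschitzWith Kψ ψ)
    {ξ : Fin n → ℝ} {om : Fin n → E} {b : Fin n → PathSpace T} {M N : Fin n → Fin n → ℝ}
    {x y : Fin n → PathSpace T} (hx : SolvesSystem hT φ ψ ξ om b M x)
    (hy : SolvesSystem hT φ ψ ξ om b N y) {C : ℝ} (hC : 0 ≤ C) (hN : ∀ i j, |N i j| ≤ C / n)
    {ε : ℝ} (hε : ∫ s in (0 : ℝ)..T,
      (n : ℝ)⁻¹ * ∑ i, interactionError hT φ om (fun i j => M i j - N i j) x i s ≤ ε) :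
    (n : ℝ)⁻¹ * ∑ i, dist (x i) (y i) ≤ ε * Real.exp (2 * (C * Kφ + Kψ + 1) * T) := by
  have hn0 : (0 : ℝ) < n := by exact_mod_cast hn
  have hKφ : (0 : ℝ) ≤ Kφ := Kφ.2
  have hKψ : (0 : ℝ) ≤ Kψ := Kψ.2
  refine average_dist_le_of_integral_inequality hT x y
    (e := interactionError hT φ om (fun i j => M i j - N i j) x)
    (continuous_interactionError hT hφ.continuous _ _ _) (fun _ _ => abs_nonneg _)
    (by positivity) hε fun i t => ?_
  have hcx := continuous_drift hT hφ.continuous hψ.continuous om M x i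
  have hcy := continuous_drift hT hφ.continuous hψ.continuous om N y i
  have hc : ∀ j, Continuous fun s =>
      |x j (Set.projIcc 0 T hT.le s) - y j (Set.projIcc 0 T hT.le s)| := fun j =>
    (((x j).continuous.comp continuous_projIcc).sub ((y j).continuous.comp continuous_projIcc)).abs
  rw [hx i t, hy i t, add_sub_add_right_eq_sub, add_sub_add_left_eq_sub,
    ← intervalIntegral.integral_sub (hcx.intervalIntegrable _ _) (hcy.intervalIntegrable _ _)]
  refine (intervalIntegral.abs_integral_le_integral_abs t.2.1).trans ?_
  refine intervalIntegral.integral_mono_on t.2.1 ((hcx.sub hcy).abs.intervalIntegrable _ _)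
    (Continuous.intervalIntegrable ?_ _ _) fun s _ => ?_
  · exact (continuous_interactionError hT hφ.continuous om _ x i).add (continuous_const.mul
      ((hc i).add (continuous_const.mul (continuous_finsetSum _ fun j _ => hc j))))
  set u := Set.projIcc 0 T hT.le s with hu
  set D : Fin n → ℝ := fun j => |x j u - y j u| with hD
  have hD0 : ∀ j, 0 ≤ D j := fun j => abs_nonneg _
  have hsplit : (∑ j, M i j * φ (x i u, x j u, om i, om j)) + ψ (x i u, om i) -
      ((∑ j, N i j * φ (y i u, y j u, om i, om j)) + ψ (y i u, om i)) =
      (∑ j, (M i j - N i j) * φ (x i u, x j u, om i, om j)) +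
      (∑ j, N i j * (φ (x i u, x j u, om i, om j) - φ (y i u, y j u, om i, om j))) +
      (ψ (x i u, om i) - ψ (y i u, om i)) := by
    simp only [sub_mul, mul_sub, Finset.sum_sub_distrib]
    ring
  have hψ' : |ψ (x i u, om i) - ψ (y i u, om i)| ≤ Kψ * D i := by
    have h := hψ.dist_le_mul (x i u, om i) (y i u, om i)
    rwa [Real.dist_eq, Prod.dist_eq, dist_self, Real.dist_eq, max_eq_left (abs_nonneg _)] at h
  have hN' : |∑ j, N i j * (φ (x i u, x j u, om i, om j) - φ (y i u, y j u, om i, om j))| ≤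
      C * Kφ * (D i + (n : ℝ)⁻¹ * ∑ j, D j) := by
    calc _ ≤ ∑ j, C / n * (Kφ * (D i + D j)) := by
          refine (Finset.abs_sum_le_sum_abs _ _).trans (Finset.sum_le_sum fun j _ => ?_)
          rw [abs_mul]
          exact mul_le_mul (hN i j) (abs_sub_le_of_lipschitzWith_fst hφ _ _ _ _ _ _)
            (abs_nonneg _) (by positivity)
      _ = _ := by
          simp only [← Finset.mul_sum, Finset.sum_add_distrib, Finset.sum_const, Finset.card_univ,
            Fintype.card_fin, nsmul_eq_mul]
          field_simp
  have havg : 0 ≤ (n : ℝ)⁻¹ * ∑ j, D j :=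
    mul_nonneg (by positivity) (Finset.sum_nonneg fun j _ => hD0 j)
  rw [hsplit]
  refine (abs_add_three _ _ _).trans ?_
  have h1 : |∑ j, (M i j - N i j) * φ (x i u, x j u, om i, om j)| =
      interactionError hT φ om (fun i j => M i j - N i j) x i s := rfl
  rw [h1]
  have h2 : (0 : ℝ) ≤ Kψ * ((n : ℝ)⁻¹ * ∑ j, D j) := mul_nonneg hKψ havg
  have h3 := hD0 i
  linarith

/-- A solution stays close to its initial condition, up to the noise, the `ψ` drift, and the degree
of the particle in the graph. -/
lemma SolvesSystem.abs_sub_init_le {E : Type*} {hT : 0 < T} {φ : ℝ × ℝ × E × E → ℝ}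
    {Mφ : ℝ} (hMφ : ∀ z, |φ z| ≤ Mφ) {ψ : ℝ × E → ℝ} {Mψ : ℝ}
    (hMψ : ∀ z, |ψ z| ≤ Mψ) {ξ : Fin n → ℝ} {om : Fin n → E} {b : Fin n → PathSpace T}
    {M : Fin n → Fin n → ℝ} (hM : ∀ i j, 0 ≤ M i j) {x : Fin n → PathSpace T}
    (hx : SolvesSystem hT φ ψ ξ om b M x) (i : Fin n) (t : Set.Icc (0 : ℝ) T) :
    |x i t - ξ i| ≤ |b i t| + T * (Mψ + Mφ * ∑ j, M i j) := by
  have hb : ∀ s : ℝ, ‖(∑ j, M i j * φ (x i (Set.projIcc 0 T hT.le s),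
      x j (Set.projIcc 0 T hT.le s), om i, om j)) + ψ (x i (Set.projIcc 0 T hT.le s), om i)‖ ≤
      Mψ + Mφ * ∑ j, M i j := fun s => by
    rw [add_comm Mψ]
    refine (norm_add_le _ _).trans (add_le_add ?_ (hMψ _))
    rw [Finset.mul_sum]
    refine (norm_sum_le _ _).trans (Finset.sum_le_sum fun j _ => ?_)
    rw [norm_mul, Real.norm_eq_abs, abs_of_nonneg (hM i j), mul_comm]
    exact mul_le_mul_of_nonneg_right (hMφ _) (hM i j)
  have h0 : 0 ≤ Mψ + Mφ * ∑ j, M i j := (norm_nonneg _).trans (hb 0)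
  have hint := intervalIntegral.norm_integral_le_of_norm_le_const (a := (0 : ℝ)) (b := t)
    fun s _ => hb s
  rw [Real.norm_eq_abs, sub_zero, abs_of_nonneg t.2.1] at hint
  rw [hx i t, add_assoc, add_sub_cancel_left, add_comm |b i t|]
  refine (abs_add_le _ _).trans (add_le_add (hint.trans ?_) le_rfl)
  rw [mul_comm]
  exact mul_le_mul_of_nonneg_right t.2.2 h0

/-- The part of `ℝ × E` in which both coordinates have norm at most `R`. -/
def boundedRegion (E : Type*) [NormedAddCommGroup E] (R : ℝ) : Set (ℝ × E) :=
  {z | ‖z.1‖ ≤ R ∧ ‖z.2‖ ≤ R}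

lemma indicator_compl_boundedRegion_le {R : ℝ} (hR : 0 < R) (θ ξ : ℝ) (a : E) :
    (boundedRegion E R)ᶜ.indicator (1 : ℝ × E → ℝ) (θ, a) ≤
      Set.indicator {z : ℝ | R / 2 < ‖z‖} (1 : ℝ → ℝ) ξ +
      Set.indicator {z : E | R < ‖z‖} (1 : E → ℝ) a + 2 / R * |θ - ξ| := by
  have h1 : 0 ≤ Set.indicator {z : ℝ | R / 2 < ‖z‖} (1 : ℝ → ℝ) ξ :=
    Set.indicator_nonneg (fun _ _ => zero_le_one) _
  have h2 : 0 ≤ Set.indicator {z : E | R < ‖z‖} (1 : E → ℝ) a :=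
    Set.indicator_nonneg (fun _ _ => zero_le_one) _
  have h3 : 0 ≤ 2 / R * |θ - ξ| := by positivity
  by_cases hmem : (θ, a) ∈ boundedRegion E R
  · rw [Set.indicator_of_notMem (by simpa using hmem)]
    linarith
  rw [Set.indicator_of_mem (by simpa using hmem), Pi.one_apply]
  by_cases ha : R < ‖a‖
  · have : Set.indicator {z : E | R < ‖z‖} (1 : E → ℝ) a = 1 := by simp [ha]
    linarith
  by_cases hξ : R / 2 < ‖ξ‖
  · have : Set.indicator {z : ℝ | R / 2 < ‖z‖} (1 : ℝ → ℝ) ξ = 1 :=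
      Set.indicator_of_mem (s := {z : ℝ | R / 2 < ‖z‖}) hξ _
    linarith
  have hθ : R < |θ| := by
    by_contra h
    exact hmem ⟨not_lt.1 h, not_lt.1 ha⟩
  rw [not_lt, Real.norm_eq_abs] at hξ
  have h4 : R / 2 ≤ |θ - ξ| := by
    have := abs_sub_abs_le_abs_sub θ ξ
    linarith
  have h5 : 1 ≤ 2 / R * |θ - ξ| := by
    rw [div_mul_eq_mul_div, le_div_iff₀ hR]
    linarith
  linarith

/-- The deterministic core of the argument. If the centred adjacency matrix has small signed sums,
few initial conditions and media variables are large, and the noise is moderate on average, then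
the error made by averaging the graph is small, uniformly over all possible solutions. -/
lemma integral_average_interactionError_le (hT : 0 < T) (hn : 0 < n) {φ : ℝ × ℝ × E × E → ℝ}
    (hφ : Continuous φ) {Mφ : ℝ} (hMφ0 : 0 ≤ Mφ) (hMφ : ∀ z, |φ z| ≤ Mφ)
    {ψ : ℝ × E → ℝ} {Mψ : ℝ} (hMψ : ∀ z, |ψ z| ≤ Mψ)
    {ξ : Fin n → ℝ} {om : Fin n → E} {b : Fin n → PathSpace T}
    {A Q : Fin n → Fin n → ℝ} {p C τ : ℝ} (hp : 0 < p) (hC : 0 ≤ C) (hτ1 : τ ≤ 1)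
    (hA : ∀ i j, 0 ≤ A i j) (hQ0 : ∀ i j, 0 ≤ Q i j) (hQ : ∀ i j, Q i j ≤ p * C)
    (hτ : ∀ u v, signedSum (fun i j => A i j - Q i j) u v ≤ τ * (n ^ 2 * p))
    {x : Fin n → PathSpace T} (hx : SolvesSystem hT φ ψ ξ om b (fun i j => A i j / (n * p)) x)
    {R δ ε κ v : ℝ} (hR : 0 < R) (hε : 0 ≤ ε) (F : Finset (ℝ × E))
    (hF : ∀ z ∈ boundedRegion E R, ∃ y ∈ F, dist z y ≤ δ)
    (hφε : ∀ z w z' w' : ℝ × E, dist z z' ≤ δ → dist w w' ≤ δ →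
      |φ (z.1, w.1, z.2, w.2) - φ (z'.1, w'.1, z'.2, w'.2)| ≤ ε)
    (hξ : ∑ i, Set.indicator {z : ℝ | R / 2 < ‖z‖} (1 : ℝ → ℝ) (ξ i) ≤ κ * n)
    (hom : ∑ i, Set.indicator {z : E | R < ‖z‖} (1 : E → ℝ) (om i) ≤ κ * n)
    (hb : ∑ i, absIntegral hT (b i) ≤ v * n) :
    ∫ s in (0 : ℝ)..T, (n : ℝ)⁻¹ * ∑ i, interactionError hT φ om
        (fun i j => A i j / (n * p) - Q i j / (n * p)) x i s ≤
      T * (((F.card : ℝ) ^ 2 + 2) * Mφ * τ + ε * (1 + 2 * C) + 8 * Mφ * C * κ) +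
        8 * Mφ * C / R * (T ^ 2 * (Mψ + Mφ * (1 + C)) + v) := by
  have hn0 : (0 : ℝ) < n := by exact_mod_cast hn
  have hnp : 0 < n ^ 2 * p := by positivity
  set D : ℝ := T * (Mψ + Mφ * (1 + C)) with hD
  -- The average degree is controlled by the signed sum over all pairs.
  have hdeg : (n : ℝ)⁻¹ * ∑ i, ∑ j, A i j / (n * p) ≤ 1 + C := by
    have h1 := hτ (fun _ => 1) (fun _ => 1)
    simp only [signedSum, SignType.coe_one, one_mul, Finset.sum_sub_distrib] at h1
    have h2 : ∑ i, ∑ j, Q i j ≤ n ^ 2 * p * C := by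
      calc _ ≤ ∑ _ : Fin n, ∑ _ : Fin n, p * C :=
            Finset.sum_le_sum fun i _ => Finset.sum_le_sum fun j _ => hQ i j
        _ = _ := by
            simp only [Finset.sum_const, Finset.card_univ, Fintype.card_fin, nsmul_eq_mul]
            ring
    have h3 : τ * (n ^ 2 * p) ≤ 1 * (n ^ 2 * p) := by gcongr
    simp only [← Finset.sum_div]
    rw [inv_mul_eq_div, div_div, div_le_iff₀ (by positivity)]
    linarith
  have hpt : ∀ s ∈ Set.Icc 0 T, (n : ℝ)⁻¹ * ∑ i, interactionError hT φ om
        (fun i j => A i j / (n * p) - Q i j / (n * p)) x i s ≤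
      (((F.card : ℝ) ^ 2 + 2) * Mφ * τ + ε * (1 + 2 * C) + 8 * Mφ * C * κ) +
        8 * Mφ * C / R * (D + (n : ℝ)⁻¹ * ∑ i, |b i (Set.projIcc 0 T hT.le s)|) := by
    intro s _
    set u := Set.projIcc 0 T hT.le s
    have hmain := sum_abs_interaction_le (V := ℝ × E) hA hQ0 hQ hτ
      (Φ := fun z w => φ (z.1, w.1, z.2, w.2)) hMφ0 (fun _ _ => hMφ _) hε hφε F hF
      fun i => (x i u, om i)
    have hscale : ∀ i, interactionError hT φ om
        (fun i j => A i j / (n * p) - Q i j / (n * p)) x i s =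
        (n * p)⁻¹ * |∑ j, (A i j - Q i j) * φ (x i u, x j u, om i, om j)| := fun i => by
      rw [interactionError, ← abs_of_pos (inv_pos.2 (mul_pos hn0 hp)), ← abs_mul, Finset.mul_sum]
      congr 1
      refine Finset.sum_congr rfl fun j _ => ?_
      simp only [u]
      ring
    have hbad : (n : ℝ)⁻¹ * ∑ i, (boundedRegion E R)ᶜ.indicator (1 : ℝ × E → ℝ) (x i u, om i) ≤
        2 * κ + 2 / R * (D + (n : ℝ)⁻¹ * ∑ i, |b i u|) := by
      have h1 : ∀ i, (boundedRegion E R)ᶜ.indicator (1 : ℝ × E → ℝ) (x i u, om i) ≤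
          Set.indicator {z : ℝ | R / 2 < ‖z‖} (1 : ℝ → ℝ) (ξ i) +
          Set.indicator {z : E | R < ‖z‖} (1 : E → ℝ) (om i) +
          2 / R * (|b i u| + T * (Mψ + Mφ * ∑ j, A i j / (n * p))) := fun i => by
        refine (indicator_compl_boundedRegion_le hR (x i u) (ξ i) (om i)).trans ?_
        gcongr
        exact hx.abs_sub_init_le hMφ hMψ (fun i j => by have := hA i j; positivity) i u
      calc _ ≤ (n : ℝ)⁻¹ * ∑ i, (Set.indicator {z : ℝ | R / 2 < ‖z‖} (1 : ℝ → ℝ) (ξ i) +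
          Set.indicator {z : E | R < ‖z‖} (1 : E → ℝ) (om i) +
          2 / R * (|b i u| + T * (Mψ + Mφ * ∑ j, A i j / (n * p)))) := by
            gcongr with i
            exact h1 i
        _ = (n : ℝ)⁻¹ * ∑ i, Set.indicator {z : ℝ | R / 2 < ‖z‖} (1 : ℝ → ℝ) (ξ i) +
            (n : ℝ)⁻¹ * ∑ i, Set.indicator {z : E | R < ‖z‖} (1 : E → ℝ) (om i) +
            2 / R * ((n : ℝ)⁻¹ * ∑ i, |b i u| +
              T * (Mψ + Mφ * ((n : ℝ)⁻¹ * ∑ i, ∑ j, A i j / (n * p)))) := by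
            simp only [Finset.sum_add_distrib, ← Finset.mul_sum, Finset.sum_const,
              Finset.card_univ, Fintype.card_fin, nsmul_eq_mul]
            field_simp
        _ ≤ (n : ℝ)⁻¹ * (κ * n) + (n : ℝ)⁻¹ * (κ * n) + 2 / R * ((n : ℝ)⁻¹ * ∑ i, |b i u| +
              T * (Mψ + Mφ * (1 + C))) := by gcongr
        _ = _ := by
            field_simp
            ring
    simp_rw [hscale]
    rw [← Finset.mul_sum]
    calc _ ≤ (n : ℝ)⁻¹ * ((n * p)⁻¹ * (((F.card : ℝ) ^ 2 + 2) * Mφ * (τ * (n ^ 2 * p)) +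
          ε * (τ * (n ^ 2 * p) + 2 * (p * C) * n ^ 2) + 4 * Mφ * (p * C) * n *
            ∑ i, (boundedRegion E R)ᶜ.indicator (1 : ℝ × E → ℝ) (x i u, om i))) := by
          gcongr
      _ = ((F.card : ℝ) ^ 2 + 2) * Mφ * τ + ε * (τ + 2 * C) + 4 * Mφ * C *
            ((n : ℝ)⁻¹ * ∑ i, (boundedRegion E R)ᶜ.indicator (1 : ℝ × E → ℝ) (x i u, om i)) := by
          field_simp
      _ ≤ ((F.card : ℝ) ^ 2 + 2) * Mφ * τ + ε * (1 + 2 * C) + 4 * Mφ * C *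
            (2 * κ + 2 / R * (D + (n : ℝ)⁻¹ * ∑ i, |b i u|)) := by gcongr
      _ = _ := by ring
  have hbc : ∀ i, Continuous fun s => |b i (Set.projIcc 0 T hT.le s)| := fun i =>
    ((b i).continuous.comp continuous_projIcc).abs
  have hbavg : Continuous fun s => (n : ℝ)⁻¹ * ∑ i, |b i (Set.projIcc 0 T hT.le s)| :=
    continuous_const.mul (continuous_finsetSum _ fun i _ => hbc i)
  refine (intervalIntegral.integral_mono_on hT.le (Continuous.intervalIntegrable ?_ _ _)
    (Continuous.intervalIntegrable ?_ _ _) hpt).trans ?_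
  · exact continuous_const.mul (continuous_finsetSum _ fun i _ =>
      continuous_interactionError hT hφ om _ x i)
  · exact continuous_const.add (continuous_const.mul (continuous_const.add hbavg))
  have hbint : ∫ s in (0 : ℝ)..T, (n : ℝ)⁻¹ * ∑ i, |b i (Set.projIcc 0 T hT.le s)| ≤ v := by
    rw [intervalIntegral.integral_const_mul,
      intervalIntegral.integral_finsetSum fun i _ => (hbc i).intervalIntegrable _ _,
      inv_mul_le_iff₀ hn0, mul_comm]
    exact hb
  have hbavg' : Continuous fun s => 8 * Mφ * C / R *
      (D + (n : ℝ)⁻¹ * ∑ i, |b i (Set.projIcc 0 T hT.le s)|) :=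
    continuous_const.mul (continuous_const.add hbavg)
  rw [intervalIntegral.integral_add (by simp) (hbavg'.intervalIntegrable _ _),
    intervalIntegral.integral_const_mul,
    intervalIntegral.integral_add (by simp) (hbavg.intervalIntegrable _ _),
    intervalIntegral.integral_const, intervalIntegral.integral_const, sub_zero, smul_eq_mul,
    smul_eq_mul]
  have hTD : T * D = T ^ 2 * (Mψ + Mφ * (1 + C)) := by rw [hD]; ring
  rw [← hTD]
  gcongr

end Pathwise

/-! ### Exponential equivalence -/

lemma BoundedWithBoundedDeriv.exists_lipschitzWith {F : Type*} [NormedAddCommGroup F]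
    [NormedSpace ℝ F] {f : F → ℝ} (hf : BoundedWithBoundedDeriv f) :
    ∃ K : NNReal, LipschitzWith K f := by
  obtain ⟨-, hd, C, hC⟩ := hf
  refine ⟨C.toNNReal, lipschitzWith_of_nnnorm_fderiv_le hd fun z => ?_⟩
  rw [← NNReal.coe_le_coe, coe_nnnorm]
  exact (hC z).trans (Real.le_coe_toNNReal C)

section Marginals

variable {E : Type*} [MeasurableSpace E] {n : ℕ} {T : ℝ} {Ω : Type*} [MeasurableSpace Ω]
  {lam : Measure ℝ} {mu : Measure E}
  {W : E → E → ℝ} {p : ℝ} {P : Measure Ω} [IsProbabilityMeasure P] {ξ : Ω → Fin n → ℝ}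
  {om : Ω → Fin n → E} {B : Ω → Fin n → PathSpace T} {A : Ω → Fin n → Fin n → ℝ}

lemma IsModelInput.isProbabilityMeasure_map_noise (h : IsModelInput lam mu W p P ξ om B A)
    (i : Fin n) : IsProbabilityMeasure (P.map fun w => B w i) :=
  Measure.isProbabilityMeasure_map
    ((measurable_pi_apply i).comp h.measurable_noise).aemeasurable

variable [IsProbabilityMeasure mu]

lemma IsModelInput.map_init (h : IsModelInput lam mu W p P ξ om B A) :
    P.map ξ = Measure.pi fun _ => lam := by
  have := h.isProbabilityMeasure_map_noise
  have h1 := congrArg (Measure.map Prod.fst) h.joint_law.map_eq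
  rw [Measure.map_map measurable_fst
    (h.measurable_init.prodMk (h.measurable_media.prodMk h.measurable_noise)),
    Measure.map_fst_prod, measure_univ, one_smul] at h1
  exact h1

variable [IsProbabilityMeasure lam]

lemma IsModelInput.map_media (h : IsModelInput lam mu W p P ξ om B A) :
    P.map om = Measure.pi fun _ => mu := by
  have := h.isProbabilityMeasure_map_noise
  have h1 := congrArg (Measure.map (Prod.fst ∘ Prod.snd)) h.joint_law.map_eq
  rw [Measure.map_map (measurable_fst.comp measurable_snd)
    (h.measurable_init.prodMk (h.measurable_media.prodMk h.measurable_noise)),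
    ← Measure.map_map (g := Prod.fst) (f := Prod.snd) measurable_fst measurable_snd,
    Measure.map_snd_prod, measure_univ, one_smul, Measure.map_fst_prod, measure_univ,
    one_smul] at h1
  exact h1

lemma IsModelInput.map_noise (h : IsModelInput lam mu W p P ξ om B A) :
    P.map B = Measure.pi fun i => P.map fun w => B w i := by
  have := h.isProbabilityMeasure_map_noise
  have h1 := congrArg (Measure.map (Prod.snd ∘ Prod.snd)) h.joint_law.map_eq
  rw [Measure.map_map (measurable_snd.comp measurable_snd)
    (h.measurable_init.prodMk (h.measurable_media.prodMk h.measurable_noise)),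
    ← Measure.map_map (g := Prod.snd) (f := Prod.snd) measurable_snd measurable_snd,
    Measure.map_snd_prod, measure_univ, one_smul, Measure.map_snd_prod, measure_univ,
    one_smul] at h1
  exact h1

/-- The total modulus of the noise is of order `n`, up to an event of exponentially small
probability with an arbitrarily prescribed rate. -/
lemma IsModelInput.measure_sum_absIntegral_gt_le (hT : 0 < T)
    (h : IsModelInput lam mu W p P ξ om B A) (L : ℝ) :
    P {w | (Real.log (2 * Real.exp (T ^ 3 / 2)) + L) * n < ∑ i, absIntegral hT (B w i)} ≤
      ENNReal.ofReal (Real.exp (-L * n)) := by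
  have := h.isProbabilityMeasure_map_noise
  have h1 := measure_pi_sum_gt_le (fun i => P.map fun w => B w i)
    (continuous_absIntegral hT).measurable (c := Real.log (2 * Real.exp (T ^ 3 / 2)))
    (fun i => by
      rw [Real.exp_log (by positivity)]
      exact (h.wiener i).lintegral_exp_absIntegral_le hT)
    (Real.log (2 * Real.exp (T ^ 3 / 2)) + L)
  rw [← h.map_noise, sub_add_cancel_left] at h1
  exact (Measure.le_map_apply h.measurable_noise.aemeasurable _).trans h1

end Marginals

lemma four_mul_exp_le (L : ℝ) (n : ℕ+) :
    4 * Real.exp (-(L + 2) * n) ≤ Real.exp (-L * n) := by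
  have h1 : (1 : ℝ) ≤ n := by exact_mod_cast one_le (a := n)
  have h2 : (4 : ℝ) ≤ Real.exp (2 * n) := by
    have h3 : (2 : ℝ) ≤ Real.exp n := by linarith [Real.add_one_le_exp (n : ℝ)]
    rw [two_mul, Real.exp_add]
    nlinarith
  calc _ ≤ Real.exp (2 * n) * Real.exp (-(L + 2) * n) := by gcongr
    _ = _ := by rw [← Real.exp_add]; ring_nf

/-- The union bound over `9 ^ n` pairs of sign vectors is absorbed once `κ n p` is large. -/
lemma nine_pow_mul_exp_le {L κ p : ℝ} {n : ℕ} (h : L + 9 ≤ κ * (n * p)) :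
    9 ^ n * Real.exp (-κ * (n ^ 2 * p)) ≤ Real.exp (-L * n) := by
  have h1 : (9 : ℝ) ≤ Real.exp 9 := by linarith [Real.add_one_le_exp (9 : ℝ)]
  calc _ ≤ Real.exp 9 ^ n * Real.exp (-κ * (n ^ 2 * p)) := by gcongr
    _ = Real.exp ((9 - κ * (n * p)) * n) := by
        rw [← Real.exp_nat_mul, ← Real.exp_add]
        ring_nf
    _ ≤ _ := by
        refine Real.exp_le_exp.2 (mul_le_mul_of_nonneg_right ?_ n.cast_nonneg)
        linarith

/-- If the probabilities decay faster than every exponential, their logarithmic rate is `-∞`. -/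
lemma limsup_inv_mul_log_eq_bot {u : ℕ+ → ℝ≥0∞}
    (h : ∀ L : ℝ, ∀ᶠ n : ℕ+ in atTop, u n ≤ ENNReal.ofReal (Real.exp (-L * n))) :
    limsup (fun n : ℕ+ => (((n : ℝ)⁻¹ : ℝ) : EReal) * ENNReal.log (u n)) atTop = ⊥ := by
  rw [EReal.eq_bot_iff_forall_lt]
  intro y
  have hle : limsup (fun n : ℕ+ => (((n : ℝ)⁻¹ : ℝ) : EReal) * ENNReal.log (u n)) atTop ≤
      ((y - 1 : ℝ) : EReal) := by
    refine limsup_le_of_le (by isBoundedDefault) ?_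
    filter_upwards [h (1 - y)] with n hn
    have hn0 : (0 : ℝ) < n := by exact_mod_cast n.pos
    calc _ ≤ (((n : ℝ)⁻¹ : ℝ) : EReal) *
          ENNReal.log (ENNReal.ofReal (Real.exp (-(1 - y) * n))) := by
          refine mul_le_mul_of_nonneg_left (ENNReal.log_le_log hn) ?_
          exact_mod_cast (inv_pos.2 hn0).le
      _ = _ := by
          rw [ENNReal.log_ofReal, if_neg (not_le.2 (Real.exp_pos _)), Real.log_exp,
            ← EReal.coe_mul]
          congr 1
          field_simp
          ring
  refine lt_of_le_of_lt hle ?_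
  exact_mod_cast sub_one_lt y

lemma exists_finset_cover_boundedRegion {E : Type*} [NormedAddCommGroup E] [ProperSpace E]
    (R : ℝ) {δ : ℝ} (hδ : 0 < δ) :
    ∃ F : Finset (ℝ × E), ∀ z ∈ boundedRegion E R, ∃ y ∈ F, dist z y ≤ δ := by
  have hc : IsCompact (boundedRegion E R) := by
    have : boundedRegion E R = Metric.closedBall (0 : ℝ) R ×ˢ Metric.closedBall (0 : E) R := by
      ext z
      simp [boundedRegion]
    rw [this]
    exact (isCompact_closedBall _ _).prod (isCompact_closedBall _ _)
  obtain ⟨t, -, htf, ht⟩ := finite_cover_balls_of_compact hc hδ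
  refine ⟨htf.toFinset, fun z hz => ?_⟩
  have := ht hz
  simp only [Set.mem_iUnion, Metric.mem_ball] at this
  obtain ⟨y, hy, hzy⟩ := this
  exact ⟨y, htf.mem_toFinset.2 hy, hzy.le⟩

lemma dist_prodMk_right {S E : Type*} [PseudoMetricSpace S] [PseudoMetricSpace E]
    (x y : S) (a : E) : dist (x, a) (y, a) = dist x y := by
  rw [Prod.dist_eq, dist_self]
  exact max_eq_left dist_nonneg

/-- The two empirical measures are `η`-close up to an event of exponentially small probability, with
an arbitrarily prescribed rate `L`. -/
lemma eventually_measure_dBL_gt_le {E : Type*} [NormedAddCommGroup E] [NormedSpace ℝ E]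
    [FiniteDimensional ℝ E] [MeasurableSpace E] [BorelSpace E] {T : ℝ} (hT : 0 < T)
    (lam : Measure ℝ) [IsProbabilityMeasure lam] (mu : Measure E) [IsProbabilityMeasure mu]
    {φ : ℝ × ℝ × E × E → ℝ} (hφ : BoundedWithBoundedDeriv φ)
    {ψ : ℝ × E → ℝ} (hψ : BoundedWithBoundedDeriv ψ) {W : E → E → ℝ} (hW : IsEdgeFunction W)
    {p : ℕ+ → ℝ} (hp : ∀ n, 0 < p n) (hpW : ∀ n a b, p n * W a b ≤ 1)
    (hnp : Tendsto (fun n : ℕ+ => (n : ℝ) * p n) atTop atTop)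
    {Ω : ℕ+ → Type*} [∀ n, MeasurableSpace (Ω n)]
    {P : ∀ n, Measure (Ω n)} [∀ n, IsProbabilityMeasure (P n)]
    {ξ : ∀ n : ℕ+, Ω n → Fin n → ℝ} {om : ∀ n : ℕ+, Ω n → Fin n → E}
    {B : ∀ n : ℕ+, Ω n → Fin n → PathSpace T} {A : ∀ n : ℕ+, Ω n → Fin n → Fin n → ℝ}
    (hinput : ∀ n, IsModelInput lam mu W (p n) (P n) (ξ n) (om n) (B n) (A n))
    {θ θbar : ∀ n : ℕ+, Ω n → Fin n → PathSpace T}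
    (hθ : ∀ n : ℕ+, ∀ᵐ w ∂(P n), SolvesSystem hT φ ψ (ξ n w) (om n w) (B n w)
      (fun i j => A n w i j / ((n : ℝ) * p n)) (θ n w))
    (hθbar : ∀ n : ℕ+, ∀ᵐ w ∂(P n), SolvesSystem hT φ ψ (ξ n w) (om n w) (B n w)
      (fun i j => W (om n w i) (om n w j) / (n : ℝ)) (θbar n w))
    {η : ℝ} (hη : 0 < η) (L : ℝ) :
    ∀ᶠ n : ℕ+ in atTop, P n {w | η < dBL
        (empiricalMeasure n (fun i => (θ n w i, om n w i)))
        (empiricalMeasure n (fun i => (θbar n w i, om n w i)))} ≤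
      ENNReal.ofReal (Real.exp (-L * n)) := by
  obtain ⟨Kφ, hKφ⟩ := hφ.exists_lipschitzWith
  obtain ⟨Kψ, hKψ⟩ := hψ.exists_lipschitzWith
  obtain ⟨⟨Mφ, hMφ⟩, -⟩ := hφ
  obtain ⟨⟨Mψ, hMψ⟩, -⟩ := hψ
  have hMφ0 : 0 ≤ Mφ := (abs_nonneg _).trans (hMφ 0)
  obtain ⟨C, hWC⟩ := hW.bounded
  have hC : 0 ≤ C := (hW.nonneg 0 0).trans (hWC 0 0)
  have hWm : Measurable fun z : E × E => W z.1 z.2 := by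
    obtain ⟨K, hK⟩ := hW.lipschitz
    exact hK.continuous.measurable
  have : ProperSpace E := FiniteDimensional.proper ℝ E
  -- The total error must be at most `ε`; each of its four contributions is made at most `ε / 4`.
  set ε : ℝ := η / Real.exp (2 * (C * Kφ + Kψ + 1) * T) with hε
  have hε0 : 0 < ε := by positivity
  have hεη : ε * Real.exp (2 * (C * Kφ + Kψ + 1) * T) = η :=
    div_mul_cancel₀ _ (Real.exp_pos _).ne'
  have hsmall : ∀ a : ℝ, 0 ≤ a → ∀ t : ℝ, t ≤ ε / (4 * (a + 1)) → 0 ≤ t → a * t ≤ ε / 4 := by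
    intro a ha t ht ht0
    rw [le_div_iff₀ (by positivity)] at ht
    nlinarith
  set κ : ℝ := ε / (4 * (T * (8 * Mφ * C) + 1)) with hκ
  have hκ0 : 0 < κ := by positivity
  set v : ℝ := Real.log (2 * Real.exp (T ^ 3 / 2)) + (L + 2) with hv
  obtain ⟨R₁, hR₁⟩ := exists_radius_measure_pi_le lam (L + 2) hκ0
  obtain ⟨R₂, hR₂⟩ := exists_radius_measure_pi_le mu (L + 2) hκ0
  set a : ℝ := 8 * Mφ * C * (T ^ 2 * (Mψ + Mφ * (1 + C)) + v) with ha
  -- Initial conditions are compared with `R / 2`, the media variables with `R`.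
  set R : ℝ := max (max (2 * R₁) R₂) (4 * |a| / ε + 1) with hR
  have hRa : 4 * |a| / ε + 1 ≤ R := le_max_right _ _
  have hR0 : 0 < R := lt_of_lt_of_le (by positivity) hRa
  have hRR₁ : R₁ ≤ R / 2 := by
    have : 2 * R₁ ≤ R := (le_max_left _ _).trans (le_max_left _ _)
    linarith
  have hRR₂ : R₂ ≤ R := (le_max_right _ _).trans (le_max_left _ _)
  have haR : 8 * Mφ * C / R * (T ^ 2 * (Mψ + Mφ * (1 + C)) + v) ≤ ε / 4 := by
    rw [div_mul_eq_mul_div, ← ha, div_le_iff₀ hR0]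
    have h1 : 4 * |a| / ε ≤ R := by linarith
    rw [div_le_iff₀ hε0] at h1
    linarith [le_abs_self a]
  set ε' : ℝ := ε / (4 * (T * (1 + 2 * C) + 1)) with hε'
  have hε'0 : 0 < ε' := by positivity
  set δ : ℝ := ε' / (Kφ + 1) with hδ
  have hδ0 : 0 < δ := by positivity
  obtain ⟨F, hF⟩ := exists_finset_cover_boundedRegion (E := E) R hδ0
  have hφε : ∀ z w z' w' : ℝ × E, dist z z' ≤ δ → dist w w' ≤ δ →
      |φ (z.1, w.1, z.2, w.2) - φ (z'.1, w'.1, z'.2, w'.2)| ≤ ε' := by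
    intro z w z' w' hz hw
    have h := hKφ.dist_le_mul (z.1, w.1, z.2, w.2) (z'.1, w'.1, z'.2, w'.2)
    rw [Real.dist_eq] at h
    have hd : dist (z.1, w.1, z.2, w.2) (z'.1, w'.1, z'.2, w'.2) ≤ δ := by
      rw [Prod.dist_eq, max_le_iff] at hz hw
      simp only [Prod.dist_eq]
      exact max_le hz.1 (max_le hw.1 (max_le hz.2 hw.2))
    refine h.trans ((mul_le_mul_of_nonneg_left hd Kφ.2).trans ?_)
    have h1 : δ * (Kφ + 1) = ε' := div_mul_cancel₀ _ (by positivity)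
    change (Kφ : ℝ) * δ ≤ ε'
    linarith
  set τ : ℝ := min 1 (ε / (4 * (T * (((F.card : ℝ) ^ 2 + 2) * Mφ) + 1))) with hτ
  have hτ0 : 0 < τ := lt_min one_pos (by positivity)
  obtain ⟨c, hc0, hc⟩ :=
    exists_measure_signedSum_gt_le hW.nonneg hW.symm hC hWC hWm hτ0
  have htotal : T * (((F.card : ℝ) ^ 2 + 2) * Mφ * τ + ε' * (1 + 2 * C) + 8 * Mφ * C * κ) +
        8 * Mφ * C / R * (T ^ 2 * (Mψ + Mφ * (1 + C)) + v) ≤ ε := by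
    have h1 := hsmall (T * (((F.card : ℝ) ^ 2 + 2) * Mφ)) (by positivity) τ
      (min_le_right _ _) hτ0.le
    have h2 := hsmall (T * (1 + 2 * C)) (by positivity) ε' le_rfl hε'0.le
    have h3 := hsmall (T * (8 * Mφ * C)) (by positivity) κ le_rfl hκ0.le
    linarith
  have hev : ∀ᶠ n : ℕ+ in atTop, (L + 2 + 9) / c ≤ (n : ℝ) * p n := hnp.eventually_ge_atTop _
  filter_upwards [hev] with n hn
  -- Each of four exceptional events has rate `L + 2`; the excess `2` absorbs the factor `4`.
  rw [div_le_iff₀' hc0] at hn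
  have hn0 : (0 : ℝ) < n := by exact_mod_cast n.pos
  set E₁ : Set (Ω n) := {w | ∃ u v, τ * ((n : ℕ) ^ 2 * p n) <
    signedSum (fun i j => A n w i j - p n * W (om n w i) (om n w j)) u v} with hE₁
  set E₂ : Set (Ω n) := {w | κ * (n : ℕ) <
    ∑ i, Set.indicator {z : ℝ | R / 2 < ‖z‖} (1 : ℝ → ℝ) (ξ n w i)} with hE₂
  set E₃ : Set (Ω n) := {w | κ * (n : ℕ) <
    ∑ i, Set.indicator {z : E | R < ‖z‖} (1 : E → ℝ) (om n w i)} with hE₃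
  set E₄ : Set (Ω n) := {w | v * (n : ℕ) < ∑ i, absIntegral hT (B n w i)} with hE₄
  have hP₁ : P n E₁ ≤ ENNReal.ofReal (Real.exp (-(L + 2) * n)) :=
    (hc n T (Ω n) lam mu (p n) (P n) (ξ n) (om n) (B n) (A n) (hp n) (hpW n) (hinput n)).trans
      (ENNReal.ofReal_le_ofReal (nine_pow_mul_exp_le hn))
  have hP₂ : P n E₂ ≤ ENNReal.ofReal (Real.exp (-(L + 2) * n)) := by
    have h := hR₁ (R / 2) hRR₁ n
    rw [← (hinput n).map_init] at h
    exact (Measure.le_map_apply (hinput n).measurable_init.aemeasurable _).trans h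
  have hP₃ : P n E₃ ≤ ENNReal.ofReal (Real.exp (-(L + 2) * n)) := by
    have h := hR₂ R hRR₂ n
    rw [← (hinput n).map_media] at h
    exact (Measure.le_map_apply (hinput n).measurable_media.aemeasurable _).trans h
  have hP₄ : P n E₄ ≤ ENNReal.ofReal (Real.exp (-(L + 2) * n)) :=
    (hinput n).measure_sum_absIntegral_gt_le hT (L + 2)
  have hincl : {w | η < dBL
        (empiricalMeasure n (fun i => (θ n w i, om n w i)))
        (empiricalMeasure n (fun i => (θbar n w i, om n w i)))} ≤ᵐ[P n]
      (E₁ ∪ E₂ ∪ E₃ ∪ E₄ : Set (Ω n)) := by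
    filter_upwards [hθ n, hθbar n] with w hw hwbar hlt
    by_contra hnot
    have hmem : w ∉ E₁ ∪ E₂ ∪ E₃ ∪ E₄ := hnot
    simp only [Set.mem_union, not_or, hE₁, hE₂, hE₃, hE₄, Set.mem_ofPred_eq, not_exists,
      not_lt] at hmem
    obtain ⟨⟨⟨h1, h2⟩, h3⟩, h4⟩ := hmem
    have hQ : (fun i j => W (om n w i) (om n w j) / (n : ℝ)) =
        fun i j => p n * W (om n w i) (om n w j) / ((n : ℝ) * p n) := by
      funext i j
      have := (hp n).ne'
      field_simp
    have herr := integral_average_interactionError_le hT n.pos hKφ.continuous hMφ0 hMφ hMψ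
      (hp n) hC (min_le_left _ _) (fun i j => by
        rcases (hinput n).zero_or_one w i j with h | h <;> rw [h]
        exact zero_le_one)
      (fun i j => mul_nonneg (hp n).le (hW.nonneg _ _))
      (fun i j => mul_le_mul_of_nonneg_left (hWC _ _) (hp n).le) h1 hw hR0 hε'0.le F hF hφε h2 h3 h4
    rw [hQ] at hwbar
    have hdist := average_dist_le_of_solvesSystem hT n.pos hKφ hKψ hw hwbar hC (fun i j => by
      rw [← congrFun (congrFun hQ i) j, abs_of_nonneg (div_nonneg (hW.nonneg _ _) hn0.le)]
      exact div_le_div_of_nonneg_right (hWC _ _) hn0.le) (herr.trans htotal)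
    rw [hεη] at hdist
    have hd := dBL_empiricalMeasure_le n (fun i => (θ n w i, om n w i))
      (fun i => (θbar n w i, om n w i))
    simp only [dist_prodMk_right] at hd
    exact absurd hlt (not_lt.2 (hd.trans hdist))
  calc _ ≤ P n (E₁ ∪ E₂ ∪ E₃ ∪ E₄) := measure_mono_ae hincl
    _ ≤ P n E₁ + P n E₂ + P n E₃ + P n E₄ := by
        refine (measure_union_le _ _).trans (add_le_add_left ?_ _)
        refine (measure_union_le _ _).trans (add_le_add_left ?_ _)
        exact measure_union_le _ _
    _ ≤ ENNReal.ofReal (Real.exp (-(L + 2) * n)) + ENNReal.ofReal (Real.exp (-(L + 2) * n)) +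
        ENNReal.ofReal (Real.exp (-(L + 2) * n)) + ENNReal.ofReal (Real.exp (-(L + 2) * n)) := by
        gcongr
    _ = ENNReal.ofReal (4 * Real.exp (-(L + 2) * n)) := by
        rw [ENNReal.ofReal_mul (by norm_num)]
        norm_num
        ring
    _ ≤ _ := ENNReal.ofReal_le_ofReal (four_mul_exp_le L n)

end SparseDiffusion

theorem theorem2 (d : ℕ) (T : ℝ) (hT : 0 < T)
    (lam : MeasureTheory.Measure ℝ) [MeasureTheory.IsProbabilityMeasure lam]
    (hlam : SparseDiffusion.HasIntegrableDensity lam)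
    (mu : MeasureTheory.Measure (EuclideanSpace ℝ (Fin d))) [MeasureTheory.IsProbabilityMeasure mu]
    (φ : ℝ × ℝ × EuclideanSpace ℝ (Fin d) × EuclideanSpace ℝ (Fin d) → ℝ)
    (hφ : SparseDiffusion.BoundedWithBoundedDeriv φ)
    (ψ : ℝ × EuclideanSpace ℝ (Fin d) → ℝ)
    (hψ : SparseDiffusion.BoundedWithBoundedDeriv ψ)
    (W : EuclideanSpace ℝ (Fin d) → EuclideanSpace ℝ (Fin d) → ℝ)
    (hW : SparseDiffusion.IsEdgeFunction W)
    (p : ℕ+ → ℝ) (hp_pos : ∀ n, 0 < p n) (hp_le : ∀ n, p n ≤ 1)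
    (hpW : ∀ n a b, p n * W a b ≤ 1)
    (hnp : Filter.Tendsto (fun n : ℕ+ => (n : ℝ) * p n) Filter.atTop Filter.atTop)
    {Ω : ℕ+ → Type*} [∀ n, MeasurableSpace (Ω n)]
    (P : ∀ n, MeasureTheory.Measure (Ω n)) [∀ n, MeasureTheory.IsProbabilityMeasure (P n)]
    (ξ : ∀ n : ℕ+, Ω n → Fin n → ℝ)
    (om : ∀ n : ℕ+, Ω n → Fin n → EuclideanSpace ℝ (Fin d))
    (B : ∀ n : ℕ+, Ω n → Fin n → SparseDiffusion.PathSpace T)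
    (A : ∀ n : ℕ+, Ω n → Fin n → Fin n → ℝ)
    (hinput : ∀ n, SparseDiffusion.IsModelInput lam mu W (p n) (P n) (ξ n) (om n) (B n) (A n))
    (θ θbar : ∀ n : ℕ+, Ω n → Fin n → SparseDiffusion.PathSpace T)
    (hθ : ∀ n : ℕ+, SparseDiffusion.IsStrongSolution hT φ ψ (P n) (ξ n) (om n) (B n)
      (SparseDiffusion.history (ξ n) (om n) (B n) (A n))
      (fun w i j => A n w i j / ((n : ℝ) * p n)) (θ n))
    (hθbar : ∀ n : ℕ+, SparseDiffusion.IsStrongSolution hT φ ψ (P n) (ξ n) (om n) (B n)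
      (SparseDiffusion.history (ξ n) (om n) (B n) (A n))
      (fun w i j => W (om n w i) (om n w j) / (n : ℝ)) (θbar n)) :
    SparseDiffusion.ExponentiallyEquivalent
      (S := MeasureTheory.ProbabilityMeasure
        (SparseDiffusion.PathSpace T × EuclideanSpace ℝ (Fin d)))
      SparseDiffusion.dBL P
      (fun n w => SparseDiffusion.empiricalMeasure n (fun i => (θ n w i, om n w i)))
      (fun n w => SparseDiffusion.empiricalMeasure n (fun i => (θbar n w i, om n w i))) := by
  have hmeas : ∀ n (X : Ω n → Fin n → SparseDiffusion.PathSpace T), AEMeasurable X (P n) →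
      AEMeasurable (fun w => SparseDiffusion.empiricalMeasure n (fun i => (X w i, om n w i)))
        (P n) := by
    intro n X hX
    refine (SparseDiffusion.measurable_empiricalMeasure n).comp_aemeasurable ?_
    refine aemeasurable_pi_lambda _ fun i => AEMeasurable.prodMk ?_ ?_
    · exact (measurable_pi_apply i).comp_aemeasurable hX
    · exact ((measurable_pi_apply i).comp (hinput n).measurable_media).aemeasurable
  refine ⟨fun n => hmeas n _ (hθ n).aemeasurable, fun n => hmeas n _ (hθbar n).aemeasurable,
    fun η hη => SparseDiffusion.limsup_inv_mul_log_eq_bot fun L => ?_⟩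
  exact SparseDiffusion.eventually_measure_dBL_gt_le hT lam mu hφ hψ hW hp_pos hpW hnp hinput
    (fun n => (hθ n).equation) (fun n => (hθbar n).equation) hη L
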